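/- A digraph is a pair $G=(V,E)$ with $V$ a nonempty set and $E\subseteq V^2$ (loops are allowed). Let $\mathcal{D}$ be the set of isomorphism types of finite digraphs, partially ordered by $G\sqsubseteq G'$ if and only if $G$ is isomorphic to the substructure of $G'$ induced on some subset of its vertices. For digraphs $C_1,\dots,C_k\in\mathcal{D}$, a relation $R\subseteq\mathcal{D}^n$ is definable in the first-order language of $(\mathcal{D};\sqsubseteq,C_1,\dots,C_k)$ if some first-order formula with free variables $x_1,\dots,x_n$, in the language of partially ordered sets with constants for $C_1,\dots,C_k$ added, holds exactly for the tuples in $R$; an element $G$ is definable if $\{G\}$ is. A digraph is weakly connected if it is connected when the direction of its edges is disregarded. The second-order language of digraphs has variables for finite digraphs, for vertices of a given digraph variable, and for relations $R\subseteq V(X_1)\times\dots\times V(X_m)$ between the vertex sets of given digraph variables $X_1,\dots,X_m$ (not necessarily distinct; this includes sets of vertices, relations on one digraph, and functions between two digraphs, as their graphs). Its atomic formulas express that two vertices of a digraph are equal, that they form an edge, or that a tuple of vertices belongs to a relation; formulas are built by the logical connectives and by quantification over all three kinds of variables. A formula $\varphi(X_1,\dots,X_n)$ whose only free variables are digraph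 variables defines an isomorphism-invariant relation between finite digraphs, hence a relation on $\mathcal{D}$. There exists a finite set $\{C_1,\dots,C_k\}$ of finite digraphs such that in the first-order language of $(\mathcal{D};\sqsubseteq,C_1,\dots,C_k)$ 1. every single digraph $G\in\mathcal{D}$ is definable; 2. the set of weakly connected digraphs is definable; 3. moreover, the full second-order language of digraphs is available: for every $n$, every $n$-ary relation on $\mathcal{D}$ that is defined by a formula $\varphi(X_1,\dots,X_n)$ of the second-order language of digraphs is definable. -/

import Mathlib

namespace DigraphOrder

open FirstOrder

/-- A finite directed graph (loops are allowed) with vertex set `{0, …, n}`. The vertex set of a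
digraph is nonempty; every finite digraph is isomorphic to one of these. -/
structure FinDigraph where
  n : ℕ
  graph : Digraph (Fin (n + 1))

namespace FinDigraph

/-- The set of vertices. -/
abbrev V (G : FinDigraph) : Type := Fin (G.n + 1)

/-- The edge relation. -/
abbrev E (G : FinDigraph) : G.V → G.V → Prop := G.graph.Adj

/-- `G` is isomorphic to the substructure of `H` induced on some subset of the vertices. -/
def Substructure (G H : FinDigraph) : Prop := Nonempty (G.E ↪r H.E)

/-- `G` and `H` are isomorphic. -/
def Isomorphic (G H : FinDigraph) : Prop := Nonempty (G.E ≃r H.E)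

/-- Disregarding the direction of the edges, the graph is connected. -/
def WeaklyConnected (G : FinDigraph) : Prop := G.graph.toSimpleGraphInclusive.Connected

theorem Substructure.antisymm {G H : FinDigraph} (h₁ : G.Substructure H) (h₂ : H.Substructure G) :
    G.Isomorphic H := by
  obtain ⟨f⟩ := h₁
  obtain ⟨g⟩ := h₂
  have h : Function.Bijective f := by
    rw [Fintype.bijective_iff_injective_and_card]
    exact ⟨f.injective, le_antisymm (Fintype.card_le_of_injective f f.injective)
      (Fintype.card_le_of_injective g g.injective)⟩
  exact ⟨RelIso.ofSurjective f h.2⟩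

instance setoid : Setoid FinDigraph where
  r := Isomorphic
  iseqv := ⟨fun _ => ⟨RelIso.refl _⟩, fun ⟨f⟩ => ⟨f.symm⟩, fun ⟨f⟩ ⟨g⟩ => ⟨f.trans g⟩⟩

end FinDigraph

/-- The set of isomorphism types of finite digraphs. -/
def IsoType : Type := Quotient FinDigraph.setoid

namespace IsoType

/-- The isomorphism type of a finite digraph. -/
def of (G : FinDigraph) : IsoType := Quotient.mk FinDigraph.setoid G

/-- The poset of isomorphism types of finite digraphs: `≤` is the substructure ordering. -/
instance : PartialOrder IsoType where
  le := Quotient.lift₂ FinDigraph.Substructure (by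
    rintro G₁ H₁ G₂ H₂ ⟨f⟩ ⟨g⟩
    exact propext
      ⟨fun ⟨e⟩ => ⟨(f.symm.toRelEmbedding.trans e).trans g.toRelEmbedding⟩,
        fun ⟨e⟩ => ⟨(f.toRelEmbedding.trans e).trans g.symm.toRelEmbedding⟩⟩)
  le_refl x := by
    induction x using Quotient.ind
    exact ⟨RelEmbedding.refl _⟩
  le_trans x y z := by
    induction x using Quotient.ind
    induction y using Quotient.ind
    induction z using Quotient.ind
    rintro ⟨f⟩ ⟨g⟩
    exact ⟨f.trans g⟩
  le_antisymm x y := by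
    induction x using Quotient.ind
    induction y using Quotient.ind
    intro h₁ h₂
    exact Quotient.sound (FinDigraph.Substructure.antisymm h₁ h₂)

/-- The poset as a structure for the first-order language of partially ordered sets. -/
instance : Language.order.Structure IsoType := Language.orderStructure IsoType

/-- The set of (isomorphism types of) weakly connected digraphs. -/
def weaklyConnected : Set IsoType := {x | ∃ G : FinDigraph, of G = x ∧ G.WeaklyConnected}

end IsoType

/-! ### The second-order language of digraphs

A many-sorted language. Its variables are: digraph variables; for each digraph variable, variables
for the vertices of that digraph; for each finite list of digraph variables `X₁, …, X_k`, variables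
for the relations `R ⊆ V(X₁) × ⋯ × V(X_k)` (in particular sets of vertices, relations of any arity
on one digraph, and graphs of functions from one digraph to another). One may quantify over all
of these; the atomic formulas say that two vertices of a digraph are equal, that they form an edge,
or that a tuple of vertices belongs to a relation. -/

/-- The variables that may occur free in a formula, with their sorts. -/
structure SOContext : Type 1 where
  /-- the digraph variables -/
  Dig : Type
  /-- the variables for vertices of a digraph -/
  Vtx : Dig → Type
  /-- the variables for relations between the vertices of some digraphs -/
  Rel : {k : ℕ} → (Fin k → Dig) → Type

namespace SOContext

/-- The context with `n` digraph variables and no others. -/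
def digraphs (n : ℕ) : SOContext := ⟨Fin n, fun _ => Empty, fun _ => Empty⟩

inductive VtxLift {D : Type} (Vtx : D → Type) : Option D → Type
  | old {i : D} (x : Vtx i) : VtxLift Vtx (some i)

inductive RelLift {D : Type} (Rel : {k : ℕ} → (Fin k → D) → Type) :
    {k : ℕ} → (Fin k → Option D) → Type
  | old {k : ℕ} {s : Fin k → D} (R : Rel s) : RelLift Rel (fun j => some (s j))

inductive VtxExt {D : Type} (Vtx : D → Type) (i : D) : D → Type
  | old {j : D} (x : Vtx j) : VtxExt Vtx i j
  | new : VtxExt Vtx i i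

inductive RelExt {D : Type} (Rel : {k : ℕ} → (Fin k → D) → Type) {m : ℕ} (t : Fin m → D) :
    {k : ℕ} → (Fin k → D) → Type
  | old {k : ℕ} {s : Fin k → D} (R : Rel s) : RelExt Rel t s
  | new : RelExt Rel t t

/-- Add a digraph variable. -/
def addDig (c : SOContext) : SOContext := ⟨Option c.Dig, VtxLift c.Vtx, RelLift c.Rel⟩

/-- Add a variable for a vertex of the digraph `i`. -/
def addVtx (c : SOContext) (i : c.Dig) : SOContext := ⟨c.Dig, VtxExt c.Vtx i, c.Rel⟩

/-- Add a variable for a relation between vertices of the digraphs `t 0, …, t (m - 1)`. -/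
def addRel (c : SOContext) {m : ℕ} (t : Fin m → c.Dig) : SOContext :=
  ⟨c.Dig, c.Vtx, RelExt c.Rel t⟩

/-- An interpretation of the variables of a context. -/
structure Assignment (c : SOContext) where
  dig : c.Dig → FinDigraph
  vtx : (i : c.Dig) → c.Vtx i → (dig i).V
  rel : (k : ℕ) → (s : Fin k → c.Dig) → c.Rel s → Set ((j : Fin k) → (dig (s j)).V)

namespace Assignment

/-- The interpretation of `n` digraph variables by given digraphs. -/
def ofDigraphs {n : ℕ} (G : Fin n → FinDigraph) : Assignment (digraphs n) where
  dig := G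
  vtx := fun _ x => nomatch x
  rel := fun _ _ x => nomatch x

/-- Interpret the new digraph variable by `G`. -/
def addDig {c : SOContext} (a : Assignment c) (G : FinDigraph) : Assignment c.addDig where
  dig
    | none => G
    | some i => a.dig i
  vtx
    | _, VtxLift.old x => a.vtx _ x
  rel
    | _, _, RelLift.old R => a.rel _ _ R

/-- Interpret the new vertex variable by `v`. -/
def addVtx {c : SOContext} (a : Assignment c) (i : c.Dig) (v : (a.dig i).V) :
    Assignment (c.addVtx i) where
  dig := a.dig
  vtx
    | _, VtxExt.old x => a.vtx _ x
    | _, VtxExt.new => v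
  rel := a.rel

/-- Interpret the new relation variable by `S`. -/
def addRel {c : SOContext} (a : Assignment c) {m : ℕ} (t : Fin m → c.Dig)
    (S : Set ((j : Fin m) → (a.dig (t j)).V)) : Assignment (c.addRel t) where
  dig := a.dig
  vtx := a.vtx
  rel
    | _, _, RelExt.old R => a.rel _ _ R
    | _, _, RelExt.new => S

end Assignment

end SOContext

/-- The second-order formulas about digraphs with free variables in a given context. The other
connectives and the existential quantifiers are abbreviations. -/
inductive SOFormula : SOContext → Type 1
  | falsum {c : SOContext} : SOFormula c
  | eq {c : SOContext} {i : c.Dig} (x y : c.Vtx i) : SOFormula c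
  | edge {c : SOContext} {i : c.Dig} (x y : c.Vtx i) : SOFormula c
  | mem {c : SOContext} {k : ℕ} {s : Fin k → c.Dig} (R : c.Rel s) (x : (j : Fin k) → c.Vtx (s j)) :
      SOFormula c
  | imp {c : SOContext} (φ ψ : SOFormula c) : SOFormula c
  | allDig {c : SOContext} (φ : SOFormula c.addDig) : SOFormula c
  | allVtx {c : SOContext} (i : c.Dig) (φ : SOFormula (c.addVtx i)) : SOFormula c
  | allRel {c : SOContext} {m : ℕ} (t : Fin m → c.Dig) (φ : SOFormula (c.addRel t)) : SOFormula c

namespace SOFormula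

/-- Truth of a second-order formula. -/
def Realize : {c : SOContext} → SOFormula c → c.Assignment → Prop
  | _, falsum, _ => False
  | _, eq x y, a => a.vtx _ x = a.vtx _ y
  | _, @edge _ i x y, a => (a.dig i).E (a.vtx i x) (a.vtx i y)
  | _, mem R x, a => (fun j => a.vtx _ (x j)) ∈ a.rel _ _ R
  | _, imp φ ψ, a => φ.Realize a → ψ.Realize a
  | _, allDig φ, a => ∀ G : FinDigraph, φ.Realize (a.addDig G)
  | _, allVtx i φ, a => ∀ v : (a.dig i).V, φ.Realize (a.addVtx i v)
  | _, allRel t φ, a => ∀ S : Set ((j : _) → (a.dig (t j)).V), φ.Realize (a.addRel t S)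

/-- The relation on isomorphism types that a second-order formula in `n` free digraph variables
defines. -/
def relation {n : ℕ} (φ : SOFormula (SOContext.digraphs n)) : Set (Fin n → IsoType) :=
  {v | ∃ G : Fin n → FinDigraph, (∀ i, IsoType.of (G i) = v i) ∧
    φ.Realize (SOContext.Assignment.ofDigraphs G)}

end SOFormula

end DigraphOrder

/-!
Chains with loops play the role of numbers. Put a vertex without a loop next to such a chain and
join it to two of its initial segments: it then carries a pair of numbers as its label, and a
digraph made of such pieces codes a binary relation on numbers. So digraphs on `{0, …, k}` are coded
by pairs `(K, S)` of elements of the poset, and what can be said about the digraph that is coded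
can be said about `(K, S)` in the language of the order with small digraphs as constants.

What remains is to define the relation "`X` has the code `(K, S)`". It is definable for chains `X`.
If it is definable for the members of a set `N`, then also for every `X` that is determined by the
patterns on at most four vertices that it contains, the number of its vertices with and without a
loop, and its position relative to the members of `N`. Attaching a chain to a digraph so as to mark
its vertices makes the digraph determined by its parts with one or two marked vertices; nine rounds
of this reach all digraphs.

Quantifiers over finite digraphs, vertices and relations thus become quantifiers over codes.
-/

namespace DigraphOrder

open FirstOrder

namespace IsoType

/-- The vertex set of a representative. -/
abbrev V (X : IsoType) : Type := (Quotient.out X).V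

/-- The edge relation of a representative. -/
abbrev E (X : IsoType) : X.V → X.V → Prop := (Quotient.out X).E

theorem of_out (X : IsoType) : of (Quotient.out X) = X := Quotient.out_eq X

theorem of_le_of {G H : FinDigraph} : of G ≤ of H ↔ Nonempty (G.E ↪r H.E) := Iff.rfl

theorem of_eq_of {G H : FinDigraph} : of G = of H ↔ Nonempty (G.E ≃r H.E) :=
  ⟨fun h => Quotient.exact h, fun h => Quotient.sound h⟩

theorem le_iff {X Y : IsoType} : X ≤ Y ↔ Nonempty (X.E ↪r Y.E) := by
  conv_lhs => rw [← of_out X, ← of_out Y]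
  exact of_le_of

theorem eq_iff {X Y : IsoType} : X = Y ↔ Nonempty (X.E ≃r Y.E) := by
  conv_lhs => rw [← of_out X, ← of_out Y]
  exact of_eq_of

/-- An isomorphism from the representative of the type of `G` onto `G`. -/
noncomputable def ofIso (G : FinDigraph) : (of G).E ≃r G.E :=
  (of_eq_of.1 (of_out (of G))).some

section

variable {V W : Type} [Finite V] [Nonempty V] [Finite W] [Nonempty W]

/-- A numbering of a finite nonempty type in the form in which `FinDigraph` has its vertices. -/
noncomputable def numbering (V : Type) [Finite V] [Nonempty V] : Fin (Nat.card V - 1 + 1) ≃ V :=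
  (finCongr (Nat.sub_add_cancel Nat.card_pos)).trans (Finite.equivFin V).symm

/-- The isomorphism type of a relation on a finite nonempty type. It lets digraphs be built on
any such type instead of on `Fin (n + 1)`. -/
noncomputable def mk (r : V → V → Prop) : IsoType :=
  of ⟨Nat.card V - 1, ⟨fun i j => r (numbering V i) (numbering V j)⟩⟩

/-- An isomorphism from the representative of `mk r` onto `r`. -/
noncomputable def mkIso (r : V → V → Prop) : (mk r).E ≃r r :=
  (ofIso _).trans ⟨numbering V, Iff.rfl⟩

theorem mk_le {r : V → V → Prop} {Y : IsoType} : mk r ≤ Y ↔ Nonempty (r ↪r Y.E) := by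
  rw [le_iff]
  exact ⟨fun ⟨e⟩ => ⟨(mkIso r).symm.toRelEmbedding.trans e⟩,
    fun ⟨e⟩ => ⟨(mkIso r).toRelEmbedding.trans e⟩⟩

theorem le_mk {r : V → V → Prop} {Y : IsoType} : Y ≤ mk r ↔ Nonempty (Y.E ↪r r) := by
  rw [le_iff]
  exact ⟨fun ⟨e⟩ => ⟨e.trans (mkIso r).toRelEmbedding⟩,
    fun ⟨e⟩ => ⟨e.trans (mkIso r).symm.toRelEmbedding⟩⟩

theorem mk_le_mk {r : V → V → Prop} {s : W → W → Prop} : mk r ≤ mk s ↔ Nonempty (r ↪r s) := by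
  rw [mk_le]
  exact ⟨fun ⟨e⟩ => ⟨e.trans (mkIso s).toRelEmbedding⟩,
    fun ⟨e⟩ => ⟨e.trans (mkIso s).symm.toRelEmbedding⟩⟩

theorem mk_subrel_le (X : IsoType) (P : X.V → Prop) [Nonempty {x // P x}] :
    mk (Subrel X.E P) ≤ X :=
  mk_le.2 ⟨Subrel.relEmbedding _ _⟩

theorem mk_eq_mk {r : V → V → Prop} {s : W → W → Prop} (e : r ≃r s) : mk r = mk s :=
  eq_iff.2 ⟨((mkIso r).trans e).trans (mkIso s).symm⟩

end

theorem mk_E (X : IsoType) : mk X.E = X := eq_iff.2 ⟨mkIso X.E⟩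

end IsoType

open IsoType

section Loops

variable {V W : Type} {r : V → V → Prop} {s : W → W → Prop} {l : Prop}

theorem iff_or_iff_not (p q : Prop) : (p ↔ q) ∨ (p ↔ ¬q) := by tauto

theorem loop_map (e : r ↪r s) {x : V} (h : r x x ↔ l) : s (e x) (e x) ↔ l := by
  rwa [e.map_rel_iff]

theorem ne_of_loop {x y : V} (hx : r x x ↔ l) (hy : r y y ↔ ¬l) : x ≠ y := by
  rintro rfl
  exact iff_not_self (hx.symm.trans hy)

/-- The number of vertices of type `l`: those with a loop if `l` holds, those without one
otherwise. -/
noncomputable def typeCount (l : Prop) (r : V → V → Prop) : ℕ := Nat.card {x // r x x ↔ l}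

theorem typeCount_congr (e : r ≃r s) (l : Prop) : typeCount l r = typeCount l s :=
  Nat.card_congr (e.toEquiv.subtypeEquiv fun _ => iff_congr e.map_rel_iff.symm Iff.rfl)

theorem typeCount_mk [Finite V] [Nonempty V] (r : V → V → Prop) (l : Prop) :
    typeCount l (mk r).E = typeCount l r :=
  typeCount_congr (mkIso r) l

theorem typeCount_eq_card (h : ∀ x, r x x ↔ l) : typeCount l r = Nat.card V := by
  simp [typeCount, h]

theorem typeCount_not_eq_zero (h : ∀ x, r x x ↔ l) : typeCount (¬l) r = 0 := by
  simp [typeCount, h]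

theorem exists_of_typeCount_pos (h : 0 < typeCount l r) : ∃ x, r x x ↔ l :=
  nonempty_subtype.1 (Nat.card_pos_iff.1 h).1

theorem card_eq_typeCount_add [Finite V] (r : V → V → Prop) (l : Prop) :
    Nat.card V = typeCount l r + typeCount (¬l) r := by
  classical
  rw [typeCount, typeCount, ← Nat.card_sum]
  exact Nat.card_congr ((Equiv.sumCompl fun x => r x x ↔ l).symm.trans
    (.sumCongr (.refl _) (Equiv.subtypeEquivRight fun _ => by tauto)))

/-- The restriction of an embedding to the vertices of type `l`. -/
def restrictType (e : r ↪r s) (l : Prop) (x : {x // r x x ↔ l}) : {y // s y y ↔ l} :=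
  ⟨e x, loop_map e x.2⟩

theorem restrictType_injective (e : r ↪r s) (l : Prop) : Function.Injective (restrictType e l) :=
  fun _ _ h => Subtype.ext (e.injective (congrArg Subtype.val h))

section

variable [Finite W]

theorem typeCount_le (e : r ↪r s) (l : Prop) : typeCount l r ≤ typeCount l s :=
  Nat.card_le_card_of_injective _ (restrictType_injective e l)

theorem exists_apply_eq_of_typeCount_le (e : r ↪r s) (h : typeCount l s ≤ typeCount l r) {y : W}
    (hy : s y y ↔ l) : ∃ x, e x = y := by
  obtain ⟨x, hx⟩ := ((restrictType_injective e l).bijective_of_nat_card_le h).2 ⟨y, hy⟩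
  exact ⟨x, congrArg Subtype.val hx⟩

theorem surjective_of_typeCount_le (e : r ↪r s) (h : ∀ l, typeCount l s ≤ typeCount l r) :
    Function.Surjective e := fun _ =>
  exists_apply_eq_of_typeCount_le e (h _) Iff.rfl

end

theorem eq_of_le_of_typeCount_le {X Y : IsoType} (h : X ≤ Y)
    (hc : ∀ l, typeCount l Y.E ≤ typeCount l X.E) : X = Y := by
  obtain ⟨e⟩ := le_iff.1 h
  exact eq_iff.2 ⟨RelIso.ofSurjective e (surjective_of_typeCount_le e hc)⟩

end Loops

/-! ### Patterns of at most four vertices -/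

/-- The possible edges and equalities between four vertices. -/
abbrev Pattern : Type := (Fin 4 → Fin 4 → Prop) × (Fin 4 → Fin 4 → Prop)

/-- Some four vertices, not necessarily distinct, have exactly the edges and equalities
prescribed by `t`. -/
def HasPattern (t : Pattern) {V : Type} (r : V → V → Prop) : Prop :=
  ∃ w : Fin 4 → V, ∀ a b, (r (w a) (w b) ↔ t.1 a b) ∧ (w a = w b ↔ t.2 a b)

section

variable {t : Pattern} {V W : Type} {r : V → V → Prop} {s : W → W → Prop}

theorem HasPattern.of_embedding (e : r ↪r s) (h : HasPattern t r) : HasPattern t s := by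
  obtain ⟨w, hw⟩ := h
  exact ⟨e ∘ w, fun a b => by simpa [e.map_rel_iff] using hw a b⟩

theorem hasPattern_congr (e : r ≃r s) : HasPattern t r ↔ HasPattern t s :=
  ⟨.of_embedding e.toRelEmbedding, .of_embedding e.symm.toRelEmbedding⟩

theorem hasPattern_self (r : V → V → Prop) (w : Fin 4 → V) :
    HasPattern (fun a b => r (w a) (w b), fun a b => w a = w b) r :=
  ⟨w, fun _ _ => ⟨Iff.rfl, Iff.rfl⟩⟩

end

/-- The isomorphism types of the digraphs with at most four vertices. They are the constants of
the theorem. -/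
noncomputable def smallDigraphs : Finset IsoType := by
  classical
  exact Finset.univ.image fun p : (Σ k : Fin 4, (Fin (k + 1) → Fin (k + 1) → Prop)) => mk p.2

theorem mk_mem_smallDigraphs {V : Type} [Finite V] [Nonempty V] (r : V → V → Prop)
    (h : Nat.card V ≤ 4) : mk r ∈ smallDigraphs := by
  classical
  have hpos : 0 < Nat.card V := Nat.card_pos
  exact Finset.mem_image.2 ⟨⟨⟨Nat.card V - 1, by omega⟩,
    fun i j => r (numbering V i) (numbering V j)⟩, Finset.mem_univ _,
    mk_eq_mk ⟨numbering V, Iff.rfl⟩⟩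

theorem hasPattern_iff_exists_smallDigraphs {t : Pattern} {X : IsoType} :
    HasPattern t X.E ↔ ∃ q ∈ smallDigraphs, HasPattern t q.E ∧ q ≤ X := by
  constructor
  · rintro ⟨w, hw⟩
    refine ⟨mk (Subrel X.E (· ∈ Set.range w)), mk_mem_smallDigraphs _ ?_, ?_, mk_subrel_le _ _⟩
    · exact (Nat.card_le_card_of_surjective _ (Set.rangeFactorization_surjective (f := w))).trans
        (by simp)
    · rw [hasPattern_congr (mkIso _)]
      exact ⟨fun a => ⟨w a, a, rfl⟩, fun a b => by simpa [Subrel, Subtype.ext_iff] using hw a b⟩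
  · rintro ⟨q, -, h, hq⟩
    exact h.of_embedding (le_iff.1 hq).some

/-! ### Definable predicates -/

/-- Definability, with parameters from `A`, of a predicate on valuations: `Set.Definable` with the
set-builder made implicit, so that the closure properties below compose under binders. -/
def DefinablePred {M : Type*} (A : Set M) (L : Language) [L.Structure M] {α : Type*}
    (p : (α → M) → Prop) : Prop :=
  A.Definable L {v | p v}

namespace DefinablePred

variable {M : Type*} {A : Set M} {L : Language} [L.Structure M] {α β : Type*}
  {p q : (α → M) → Prop}

theorem congr (hp : DefinablePred A L p) (h : ∀ v, p v ↔ q v) : DefinablePred A L q := by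
  rwa [show q = p from funext fun v => propext (h v).symm]

theorem not (hp : DefinablePred A L p) : DefinablePred A L fun v => ¬p v := hp.compl

theorem and (hp : DefinablePred A L p) (hq : DefinablePred A L q) :
    DefinablePred A L fun v => p v ∧ q v :=
  hp.inter hq

theorem imp (hp : DefinablePred A L p) (hq : DefinablePred A L q) :
    DefinablePred A L fun v => p v → q v :=
  congr (p := fun v => ¬p v ∨ q v) (Set.Definable.union hp.not hq) fun _ => imp_iff_not_or.symm

theorem iff (hp : DefinablePred A L p) (hq : DefinablePred A L q) :
    DefinablePred A L fun v => p v ↔ q v :=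
  ((hp.imp hq).and (hq.imp hp)).congr fun _ => iff_def.symm

theorem const (P : Prop) : DefinablePred A L fun _ : α → M => P := by
  by_cases h : P
  · simp [DefinablePred, h]
  · simp [DefinablePred, h]

theorem comp (hp : DefinablePred A L p) (f : α → β) :
    DefinablePred A L fun v : β → M => p fun a => v (f a) :=
  hp.preimage_comp f

theorem comp_sumElim {γ : Type*} (hp : DefinablePred A L p) (f : α → β ⊕ γ) :
    DefinablePred A L fun w : β ⊕ γ → M =>
      p fun a => Sum.elim (fun b => w (.inl b)) (fun c => w (.inr c)) (f a) :=
  (hp.comp f).congr fun w =>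
    Iff.of_eq (congrArg (fun u => p fun a => u (f a)) (Sum.elim_comp_inl_inr w).symm)

theorem exists_tuple [Finite β] {p : (α → M) → (β → M) → Prop}
    (hp : DefinablePred A L fun w : α ⊕ β → M => p (fun a => w (.inl a)) (fun b => w (.inr b))) :
    DefinablePred A L fun v => ∃ x, p v x := by
  obtain ⟨φ, hφ⟩ := hp
  refine ⟨φ.iExs β, Set.ext fun v => ?_⟩
  simp only [Set.mem_ofPred_eq, Language.Formula.realize_iExs]
  refine exists_congr fun x => ?_
  simpa using Set.ext_iff.1 hφ (Sum.elim v x)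

theorem exists_elem {p : (α → M) → M → Prop}
    (hp : DefinablePred A L fun w : α ⊕ Unit → M => p (fun a => w (.inl a)) (w (.inr ()))) :
    DefinablePred A L fun v => ∃ x, p v x :=
  (exists_tuple (p := fun v x => p v (x ())) hp).congr fun _ =>
    ⟨fun ⟨x, h⟩ => ⟨x (), h⟩, fun ⟨x, h⟩ => ⟨fun _ => x, h⟩⟩

theorem forall_tuple [Finite β] {p : (α → M) → (β → M) → Prop}
    (hp : DefinablePred A L fun w : α ⊕ β → M => p (fun a => w (.inl a)) (fun b => w (.inr b))) :
    DefinablePred A L fun v => ∀ x, p v x :=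
  (exists_tuple (p := fun v x => ¬p v x) hp.not).not.congr fun _ => by simp

theorem forall_elem {p : (α → M) → M → Prop}
    (hp : DefinablePred A L fun w : α ⊕ Unit → M => p (fun a => w (.inl a)) (w (.inr ()))) :
    DefinablePred A L fun v => ∀ x, p v x :=
  (exists_elem (p := fun v x => ¬p v x) hp.not).not.congr fun _ => by simp

theorem forall_index {ι : Sort*} [Finite ι] {p : ι → (α → M) → Prop}
    (hp : ∀ i, DefinablePred A L (p i)) : DefinablePred A L fun v => ∀ i, p i v := by
  have h := Set.definable_iInter_of_finite (ι := PLift ι) fun i => hp i.down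
  have hset : (⋂ i : PLift ι, {v | p i.down v}) = {v | ∀ i, p i v} := by
    ext
    simp [PLift.forall]
  rwa [hset] at h

theorem exists_index {ι : Sort*} [Finite ι] {p : ι → (α → M) → Prop}
    (hp : ∀ i, DefinablePred A L (p i)) : DefinablePred A L fun v => ∃ i, p i v :=
  (forall_index fun i => (hp i).not).not.congr fun v => by simp

theorem eq_of_mem {a : M} (ha : a ∈ A) (i : α) : DefinablePred A L fun v => v i = a := by
  have h : DefinablePred A L fun v : Fin 1 → M => v 0 = a :=
    Set.Definable.singleton_of_mem (L := L) ha
  exact h.comp fun _ => i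

theorem subst {m : M} {p : (α → M) → M → Prop}
    (hm : DefinablePred A L fun v : Unit → M => v () = m)
    (hp : DefinablePred A L fun w : α ⊕ Unit → M => p (fun a => w (.inl a)) (w (.inr ()))) :
    DefinablePred A L fun v => p v m :=
  (exists_elem ((hm.comp fun _ => .inr ()).and hp)).congr fun _ => exists_eq_left

end DefinablePred

/-- Definability in the poset of digraphs with the digraphs on at most four vertices as
constants. -/
abbrev OrderDefinable {α : Type} (p : (α → IsoType) → Prop) : Prop :=
  DefinablePred (smallDigraphs : Set IsoType) Language.order p

namespace OrderDefinable

variable {α : Type}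

theorem le (i j : α) : OrderDefinable fun v => v i ≤ v j := by
  have : Language.order.OrderedStructure IsoType := ⟨fun _ => Iff.rfl⟩
  refine Set.Definable.mono ?_ (Set.empty_subset _)
  rw [Set.empty_definable_iff]
  exact ⟨(Language.var (Sum.inl i)).le (Language.var (Sum.inl j)), by
    ext v; simp [Language.Formula.Realize, Language.Term.realize_le]⟩

theorem eq (i j : α) : OrderDefinable fun v => v i = v j :=
  ((le i j).and (le j i)).congr fun _ => antisymm_iff

theorem le_of_mem_smallDigraphs {q : IsoType} (hq : q ∈ smallDigraphs) (i : α) :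
    OrderDefinable fun v => q ≤ v i :=
  .subst (.eq_of_mem hq ()) (le _ _)

theorem hasPattern (t : Pattern) (i : α) : OrderDefinable fun v => HasPattern t (v i).E :=
  (DefinablePred.exists_index fun q : smallDigraphs =>
    (DefinablePred.const (HasPattern t q.1.E)).and (le_of_mem_smallDigraphs q.2 i)).congr
      fun v => by
        rw [hasPattern_iff_exists_smallDigraphs]
        exact ⟨fun ⟨q, h⟩ => ⟨q.1, q.2, h⟩, fun ⟨q, hq, h⟩ => ⟨⟨q, hq⟩, h⟩⟩

theorem forall_vertices (θ : (Fin 4 → Fin 4 → Prop) → (Fin 4 → Fin 4 → Prop) → Prop) (i : α) :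
    OrderDefinable fun v => ∀ w : Fin 4 → (v i).V,
      θ (fun a b => (v i).E (w a) (w b)) (fun a b => w a = w b) :=
  (DefinablePred.forall_index fun t : Pattern =>
    (hasPattern t i).imp (.const (θ t.1 t.2))).congr fun v => by
      refine ⟨fun h w => h _ (hasPattern_self _ w), ?_⟩
      rintro h t ⟨w, hw⟩
      rw [show t.1 = fun a b => (v i).E (w a) (w b) from
          funext₂ fun a b => propext (hw a b).1.symm,
        show t.2 = fun a b => w a = w b from funext₂ fun a b => propext (hw a b).2.symm]
      exact h w

end OrderDefinable

/-! ### Chains -/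

/-- The linear order on `n + 1` points, with loops if `l`. -/
def chainRel (l : Prop) (n : ℕ) (i j : Fin (n + 1)) : Prop := i < j ∨ i = j ∧ l

/-- The isomorphism type of the linear order on `n + 1` points, with loops if `l`. -/
noncomputable def chain (l : Prop) (n : ℕ) : IsoType := mk (chainRel l n)

/-- The reflexive chains play the role of the natural numbers. -/
noncomputable abbrev numeral (n : ℕ) : IsoType := chain True n

/-- The vertices of type `l` form a linear order. -/
def ChainOn (l : Prop) {V : Type} (r : V → V → Prop) : Prop :=
  ∀ x y z, (r x x ↔ l) → (r y y ↔ l) → (r z z ↔ l) → x ≠ y →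
    (r x y ↔ ¬r y x) ∧ (y ≠ z → r x y → r y z → r x z)

section

variable {l : Prop} {m n : ℕ} {V W : Type} {r : V → V → Prop} {s : W → W → Prop} {X Y : IsoType}

theorem chainRel_self (i : Fin (n + 1)) : chainRel l n i i ↔ l := by simp [chainRel]

theorem chainRel_of_ne {i j : Fin (n + 1)} (h : i ≠ j) : chainRel l n i j ↔ i < j := by
  simp [chainRel, h]

theorem typeCount_chainRel (l : Prop) (n : ℕ) : typeCount l (chainRel l n) = n + 1 := by
  rw [typeCount_eq_card chainRel_self, Nat.card_fin]

theorem typeCount_not_chainRel (l : Prop) (n : ℕ) : typeCount (¬l) (chainRel l n) = 0 :=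
  typeCount_not_eq_zero chainRel_self

theorem typeCount_chain (l : Prop) (n : ℕ) : typeCount l (chain l n).E = n + 1 := by
  rw [chain, typeCount_mk, typeCount_chainRel]

/-- The inclusion of an initial segment. -/
def initialSegment (l : Prop) (h : m ≤ n) : chainRel l m ↪r chainRel l n :=
  ⟨Fin.castLEEmb (by omega), by simp [chainRel]⟩

theorem apply_eq_of_same_range (f g : chainRel l n ↪r s) (h : ∀ i, ∃ j, g j = f i)
    (i : Fin (n + 1)) : f i = g i := by
  choose k hk using h
  have hmono : StrictMono k := fun a b hab => by
    have hne : k a ≠ k b := fun he => hab.ne (f.injective (by rw [← hk, ← hk, he]))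
    have hle : chainRel l n a b := Or.inl hab
    rwa [← f.map_rel_iff, ← hk, ← hk, g.map_rel_iff, chainRel_of_ne hne] at hle
  have hid : k = id := (hmono.range_inj strictMono_id).1 (by
    rw [Set.range_id, (Finite.surjective_of_injective hmono.injective).range_eq])
  rw [← hk, hid, id]

theorem chain_le_chain : chain l m ≤ chain l n ↔ m ≤ n := by
  refine ⟨fun h => ?_, fun h => mk_le_mk.2 ⟨initialSegment l h⟩⟩
  have := typeCount_le (le_iff.1 h).some l
  rw [typeCount_chain, typeCount_chain] at this
  omega

theorem chain_inj : chain l m = chain l n ↔ m = n := by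
  rw [le_antisymm_iff, chain_le_chain, chain_le_chain, le_antisymm_iff]

theorem ChainOn.of_embedding (e : r ↪r s) (h : ChainOn l s) : ChainOn l r :=
  fun x y z hx hy hz hxy => by
    simpa only [e.map_rel_iff, ne_eq, e.injective.eq_iff] using
      h (e x) (e y) (e z) (loop_map e hx) (loop_map e hy) (loop_map e hz) (e.injective.ne hxy)

theorem chainOn_chainRel (l : Prop) (n : ℕ) : ChainOn l (chainRel l n) :=
  fun x y z _ _ _ hxy => by
    rw [chainRel_of_ne hxy, chainRel_of_ne hxy.symm]
    refine ⟨by omega, fun hyz h₁ h₂ => ?_⟩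
    rw [chainRel_of_ne hyz] at h₂
    exact Or.inl (h₁.trans h₂)

theorem ChainOn.isStrictTotalOrder (h : ChainOn l r) :
    IsStrictTotalOrder {x // r x x ↔ l} fun x y => x ≠ y ∧ r x y where
  trichotomous x y hxy hyx := by
    by_contra hne
    have := (h x y x x.2 y.2 x.2 (Subtype.coe_ne_coe.2 hne)).1
    tauto
  irrefl x hx := hx.1 rfl
  trans x y z hxy hyz := by
    have hne := Subtype.coe_ne_coe.2 hxy.1
    refine ⟨?_, (h x y z x.2 y.2 z.2 hne).2 (Subtype.coe_ne_coe.2 hyz.1) hxy.2 hyz.2⟩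
    rintro rfl
    exact (h x y x x.2 y.2 x.2 hne).1.1 hxy.2 hyz.2

theorem ChainOn.exists_embedding [Finite V] (h : ChainOn l r) (hn : typeCount l r = n + 1) :
    Nonempty (chainRel l n ↪r r) := by
  classical
  have := h.isStrictTotalOrder
  let _ := linearOrderOfSTO fun x y : {x // r x x ↔ l} => x ≠ y ∧ r x y
  have _ := Fintype.ofFinite {x // r x x ↔ l}
  let e := Fintype.orderIsoFinOfCardEq {x // r x x ↔ l} (Nat.card_eq_fintype_card.symm.trans hn)
  refine ⟨⟨e.toEquiv.toEmbedding.trans (.subtype _), fun {i j} => ?_⟩⟩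
  obtain rfl | hij := eq_or_ne i j
  · exact (e i).2.trans (chainRel_self i).symm
  · rw [chainRel_of_ne hij, ← e.lt_iff_lt]
    exact ⟨fun hr => ⟨e.injective.ne hij, hr⟩, fun hlt => hlt.2⟩

theorem ChainOn.exists_embedding_of_lt [Finite V] (h : ChainOn l r) (hm : m < typeCount l r) :
    Nonempty (chainRel l m ↪r r) := by
  obtain ⟨f⟩ := h.exists_embedding (n := typeCount l r - 1) (by omega)
  exact ⟨(initialSegment l (by omega)).trans f⟩

theorem typeCount_le_of_chain_le {R : IsoType} (hR : ChainOn l R.E)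
    (h : ∀ m, chain l m ≤ R → chain l m ≤ Y) : typeCount l R.E ≤ typeCount l Y.E := by
  refine le_of_forall_lt fun m hm => ?_
  have hle := typeCount_le (mk_le.1 (h m (mk_le.2 (hR.exists_embedding_of_lt hm)))).some l
  rw [typeCount_chainRel] at hle
  omega

theorem eq_chain (h : ∀ x, X.E x x ↔ l) (hX : ChainOn l X.E) :
    X = chain l (Nat.card X.V - 1) := by
  have hcard : Nat.card X.V - 1 + 1 = Nat.card X.V := Nat.sub_add_cancel Nat.card_pos
  have htype : typeCount l X.E = Nat.card X.V := typeCount_eq_card h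
  have hle : chain l (Nat.card X.V - 1) ≤ X :=
    mk_le.2 (hX.exists_embedding (htype.trans hcard.symm))
  refine (eq_of_le_of_typeCount_le hle fun l' => ?_).symm
  rcases iff_or_iff_not l' l with hl | hl <;> rw [hl]
  · rw [typeCount_chain, htype, hcard]
  · rw [typeCount_not_eq_zero h]
    exact Nat.zero_le _

theorem loop_chain (l : Prop) (n : ℕ) (x : (chain l n).V) : (chain l n).E x x ↔ l :=
  (mkIso (chainRel l n)).map_rel_iff.symm.trans (chainRel_self _)

theorem chainOn_chain (l : Prop) (n : ℕ) : ChainOn l (chain l n).E :=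
  (chainOn_chainRel l n).of_embedding (mkIso (chainRel l n)).toRelEmbedding

theorem exists_eq_chain_iff : (∃ n, X = chain l n) ↔ (∀ x, X.E x x ↔ l) ∧ ChainOn l X.E := by
  refine ⟨?_, fun h => ⟨_, eq_chain h.1 h.2⟩⟩
  rintro ⟨n, rfl⟩
  exact ⟨loop_chain l n, chainOn_chain l n⟩

theorem le_chain_iff : X ≤ chain l n ↔ ∃ m ≤ n, X = chain l m := by
  constructor
  · intro h
    obtain ⟨e⟩ := le_iff.1 h
    obtain ⟨m, rfl⟩ : ∃ m, X = chain l m := exists_eq_chain_iff.2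
      ⟨fun x => e.map_rel_iff.symm.trans (loop_chain l n _), (chainOn_chain l n).of_embedding e⟩
    exact ⟨m, chain_le_chain.1 h, rfl⟩
  · rintro ⟨m, hm, rfl⟩
    exact chain_le_chain.2 hm

end

/-! ### Degrees over the vertices of type `l` -/

/-- An edge from `x` to `y` or from `y` to `x`, according to `b`. -/
def Arc (b : Bool) {V : Type} (r : V → V → Prop) (x y : V) : Prop := if b then r x y else r y x

/-- The number of vertices of type `l` joined to `x` in the direction `b`. -/
noncomputable def degree (b : Bool) (l : Prop) {V : Type} (r : V → V → Prop) (x : V) : ℕ :=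
  Nat.card {y // (r y y ↔ l) ∧ Arc b r x y}

/-- All vertices not of type `l` are joined in the direction `b` to all vertices of type `l`, and
there is a vertex not of type `l`. -/
def FullyJoined (b : Bool) (l : Prop) {V : Type} (r : V → V → Prop) : Prop :=
  (∃ x, r x x ↔ ¬l) ∧ ∀ x y, (r x x ↔ ¬l) → (r y y ↔ l) → Arc b r x y

/-- At most one vertex is not of type `l`. -/
def AtMostOneOther (l : Prop) {V : Type} (r : V → V → Prop) : Prop :=
  ∀ x y, (r x x ↔ ¬l) → (r y y ↔ ¬l) → x = y

/-- Some fully joined digraph lies between `T` and `Y`. For a chain `T` this compares the degree of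
a vertex of `Y` with the length of `T` in terms of the ordering. -/
def HasFullJoin (b : Bool) (l : Prop) (Y T : IsoType) : Prop :=
  ∃ W, W ≤ Y ∧ T ≤ W ∧ FullyJoined b l W.E

section

variable {b : Bool} {l : Prop} {m : ℕ} {V W : Type} {r : V → V → Prop} {s : W → W → Prop}
  {Y : IsoType}

theorem arc_map (e : r ↪r s) {x y : V} : Arc b s (e x) (e y) ↔ Arc b r x y := by
  cases b <;> simp [Arc, e.map_rel_iff]

theorem degree_of_embedding (e : r ↪r s) (he : ∀ y, (s y y ↔ l) → ∃ x, e x = y) (x : V) :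
    degree b l s (e x) = degree b l r x := by
  refine (Nat.card_congr (Equiv.ofBijective
    (fun y : {y // (r y y ↔ l) ∧ Arc b r x y} =>
      (⟨e y, loop_map e y.2.1, (arc_map e).2 y.2.2⟩ : {y // (s y y ↔ l) ∧ Arc b s (e x) y}))
    ⟨fun y z hyz => ?_, ?_⟩)).symm
  · exact Subtype.ext (e.injective (congrArg Subtype.val hyz))
  · rintro ⟨y, hy, hxy⟩
    obtain ⟨y, rfl⟩ := he y hy
    exact ⟨⟨y, e.map_rel_iff.symm.trans hy, (arc_map e).1 hxy⟩, rfl⟩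

theorem FullyJoined.of_relIso (e : r ≃r s) (h : FullyJoined b l r) : FullyJoined b l s := by
  obtain ⟨⟨x, hx⟩, h⟩ := h
  refine ⟨⟨e x, loop_map e.toRelEmbedding hx⟩, fun x y hx hy => ?_⟩
  rw [← arc_map e.symm.toRelEmbedding]
  exact h _ _ (loop_map e.symm.toRelEmbedding hx) (loop_map e.symm.toRelEmbedding hy)

theorem AtMostOneOther.of_embedding (e : r ↪r s) (h : AtMostOneOther l s) : AtMostOneOther l r :=
  fun _ _ hx hy => e.injective (h _ _ (loop_map e hx) (loop_map e hy))

theorem lt_degree_of_hasFullJoin (hone : AtMostOneOther l Y.E) {y : Y.V} (hy : Y.E y y ↔ ¬l)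
    (h : HasFullJoin b l Y (chain l m)) : m < degree b l Y.E y := by
  obtain ⟨W, hW, hT, ⟨x, hx⟩, hfull⟩ := h
  obtain ⟨g⟩ := le_iff.1 hW
  obtain ⟨t⟩ := mk_le.1 hT
  obtain rfl : g x = y := hone _ _ (loop_map g hx) hy
  have hcard := Nat.card_le_card_of_injective
    (fun i => (⟨g (t i), loop_map g (loop_map t (chainRel_self i)),
      (arc_map g).2 (hfull _ _ hx (loop_map t (chainRel_self i)))⟩ :
      {y // (Y.E y y ↔ l) ∧ Arc b Y.E (g x) y}))
    fun _ _ hij => t.injective (g.injective (congrArg Subtype.val hij))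
  rwa [Nat.card_fin] at hcard

theorem hasFullJoin_of_lt_degree (hY : ChainOn l Y.E) (hone : AtMostOneOther l Y.E) {y : Y.V}
    (hy : Y.E y y ↔ ¬l) (hm : m < degree b l Y.E y) : HasFullJoin b l Y (chain l m) := by
  let P : Y.V → Prop := fun z => z = y ∨ (Y.E z z ↔ l) ∧ Arc b Y.E y z
  have : Nonempty {z // P z} := ⟨y, .inl rfl⟩
  have hle : degree b l Y.E y ≤ typeCount l (Subrel Y.E P) := Nat.card_le_card_of_injective
    (fun z => (⟨⟨z, .inr z.2⟩, z.2.1⟩ : {x // Subrel Y.E P x x ↔ l}))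
    fun _ _ h => Subtype.ext (congrArg (fun x => (x.1.1 : Y.V)) h)
  refine ⟨mk (Subrel Y.E P), mk_subrel_le _ _, mk_le_mk.2 ?_, .of_relIso (mkIso _).symm
    ⟨⟨⟨y, .inl rfl⟩, hy⟩, ?_⟩⟩
  · exact (hY.of_embedding (Subrel.relEmbedding _ _)).exists_embedding_of_lt (hm.trans_le hle)
  · rintro ⟨x, hx⟩ ⟨z, hz⟩ hxl hzl
    obtain rfl : x = y := hone _ _ hxl hy
    rcases hz with rfl | ⟨-, hz⟩
    · exact (ne_of_loop (r := Y.E) hzl hy rfl).elim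
    · exact (arc_map (Subrel.relEmbedding Y.E P)).1 hz

theorem hasFullJoin_chain_iff (hY : ChainOn l Y.E) (hone : AtMostOneOther l Y.E) {y : Y.V}
    (hy : Y.E y y ↔ ¬l) : HasFullJoin b l Y (chain l m) ↔ m < degree b l Y.E y :=
  ⟨lt_degree_of_hasFullJoin hone hy, hasFullJoin_of_lt_degree hY hone hy⟩

end

/-! ### Labels -/

/-- `M` and `T` are chains of the same length, `M` with loops and `T` of type `l`. -/
def SameLength (l : Prop) (M T : IsoType) : Prop := ∃ m, M = numeral m ∧ T = chain l m

/-- The pair of numbers `(A, B)` is the label of a vertex of `R`: the clauses about `Y` say, in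
terms of the ordering, that `Y` consists of all vertices of type `l` and of one further vertex,
with degrees `A + 1` and `B + 1`. -/
def HasLabel (l : Prop) (R A B : IsoType) : Prop :=
  ∃ Y, Y ≤ R ∧ AtMostOneOther l Y.E ∧ ∀ M T, SameLength l M T →
    (T ≤ R → T ≤ Y) ∧ (HasFullJoin true l Y T ↔ M ≤ A) ∧ (HasFullJoin false l Y T ↔ M ≤ B)

section

variable {l : Prop} {a b : ℕ} {R : IsoType}

theorem exists_degree_of_hasLabel (hR : ChainOn l R.E) (h : HasLabel l R (numeral a) (numeral b)) :
    ∃ z, (R.E z z ↔ ¬l) ∧ degree true l R.E z = a + 1 ∧ degree false l R.E z = b + 1 := by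
  obtain ⟨Y, hY, hone, h⟩ := h
  replace h := fun m => h (numeral m) (chain l m) ⟨m, rfl, rfl⟩
  simp only [chain_le_chain] at h
  obtain ⟨e⟩ := le_iff.1 hY
  obtain ⟨y, hy⟩ : ∃ y, Y.E y y ↔ ¬l := by
    obtain ⟨W, hW, -, ⟨w, hw⟩, -⟩ := (h 0).2.1.2 (Nat.zero_le a)
    exact ⟨_, loop_map (le_iff.1 hW).some hw⟩
  simp only [hasFullJoin_chain_iff (hR.of_embedding e) hone hy] at h
  have hcover : ∀ z, (R.E z z ↔ l) → ∃ x, e x = z := fun _ =>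
    exists_apply_eq_of_typeCount_le e (typeCount_le_of_chain_le hR fun m => (h m).1)
  refine ⟨e y, loop_map e hy, ?_, ?_⟩ <;> rw [degree_of_embedding e hcover]
  · have := (h a).2.1
    have := (h (a + 1)).2.1
    omega
  · have := (h b).2.2
    have := (h (b + 1)).2.2
    omega

theorem hasLabel_of_degree (hR : ChainOn l R.E) {z : R.V} (hz : R.E z z ↔ ¬l)
    (ha : degree true l R.E z = a + 1) (hb : degree false l R.E z = b + 1) :
    HasLabel l R (numeral a) (numeral b) := by
  let P : R.V → Prop := fun y => y = z ∨ (R.E y y ↔ l)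
  have : Nonempty {y // P y} := ⟨z, .inl rfl⟩
  let e : (mk (Subrel R.E P)).E ↪r R.E :=
    (mkIso _).toRelEmbedding.trans (Subrel.relEmbedding _ _)
  obtain ⟨y, hy⟩ : ∃ y, e y = z :=
    ⟨(mkIso _).symm ⟨z, .inl rfl⟩, congrArg Subtype.val ((mkIso _).apply_symm_apply _)⟩
  have hcover : ∀ x, (R.E x x ↔ l) → ∃ y, e y = x := fun x hx =>
    ⟨(mkIso _).symm ⟨x, .inr hx⟩, congrArg Subtype.val ((mkIso _).apply_symm_apply _)⟩
  have hone : AtMostOneOther l (mk (Subrel R.E P)).E := .of_embedding (mkIso _).toRelEmbedding (by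
    rintro ⟨x, hx⟩ ⟨y, hy⟩ hxl hyl
    obtain rfl := hx.resolve_right fun h => ne_of_loop h hxl rfl
    obtain rfl := hy.resolve_right fun h => ne_of_loop h hyl rfl
    rfl)
  have hyl : (mk (Subrel R.E P)).E y y ↔ ¬l := by rwa [← e.map_rel_iff, hy]
  refine ⟨_, mk_subrel_le R P, hone, ?_⟩
  rintro _ _ ⟨m, rfl, rfl⟩
  rw [hasFullJoin_chain_iff (hR.of_embedding e) hone hyl,
    hasFullJoin_chain_iff (hR.of_embedding e) hone hyl, ← degree_of_embedding e hcover,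
    ← degree_of_embedding e hcover, hy, ha, hb, chain_le_chain, chain_le_chain, Nat.lt_succ_iff,
    Nat.lt_succ_iff]
  refine ⟨fun h => mk_le_mk.2 ?_, Iff.rfl, Iff.rfl⟩
  obtain ⟨f⟩ := mk_le.1 h
  exact ⟨f.codRestrict P fun i => .inr (loop_map f (chainRel_self i))⟩

theorem hasLabel_iff (hR : ChainOn l R.E) : HasLabel l R (numeral a) (numeral b) ↔
    ∃ z, (R.E z z ↔ ¬l) ∧ degree true l R.E z = a + 1 ∧ degree false l R.E z = b + 1 :=
  ⟨exists_degree_of_hasLabel hR, fun ⟨_, hz, ha, hb⟩ => hasLabel_of_degree hR hz ha hb⟩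

end

/-- The digraph `s` next to a chain of `n + 1` vertices of type `l`, where a vertex `x` of `s` is
joined in the direction `b` to the first `lab b x` vertices of the chain. -/
def labelled (l : Prop) (n : ℕ) {W : Type} (s : W → W → Prop) (lab : Bool → W → ℕ) :
    Fin (n + 1) ⊕ W → Fin (n + 1) ⊕ W → Prop
  | .inl i, .inl j => chainRel l n i j
  | .inl i, .inr x => i < lab false x
  | .inr x, .inl i => i < lab true x
  | .inr x, .inr y => s x y

section

variable {l : Prop} {n : ℕ} {W : Type} {s : W → W → Prop} {lab : Bool → W → ℕ}

/-- The chain in a labelled digraph. -/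
def labelledChain (l : Prop) (n : ℕ) (s : W → W → Prop) (lab : Bool → W → ℕ) :
    chainRel l n ↪r labelled l n s lab := ⟨⟨Sum.inl, Sum.inl_injective⟩, Iff.rfl⟩

/-- The labelled vertices in a labelled digraph. -/
def labelledVertices (l : Prop) (n : ℕ) (s : W → W → Prop) (lab : Bool → W → ℕ) :
    s ↪r labelled l n s lab := ⟨⟨Sum.inr, Sum.inr_injective⟩, Iff.rfl⟩

/-- An embedding of digraphs, extended by the identity on the chain. -/
def labelledMap (l : Prop) (n : ℕ) {W' : Type} {s : W → W → Prop} {s' : W' → W' → Prop}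
    (e : s' ↪r s) (lab : Bool → W → ℕ) :
    labelled l n s' (fun b x => lab b (e x)) ↪r labelled l n s lab :=
  ⟨⟨Sum.map id e, Function.injective_id.sumMap e.injective⟩, by
    rintro (i | x) (j | y) <;> simp [labelled, e.map_rel_iff]⟩

theorem arc_labelled {b : Bool} {x : W} {i : Fin (n + 1)} :
    Arc b (labelled l n s lab) (.inr x) (.inl i) ↔ i < lab b x := by
  cases b <;> simp [Arc, labelled]

theorem exists_eq_inl_of_loop (hs : ∀ x, s x x ↔ ¬l) {z : Fin (n + 1) ⊕ W}
    (hz : labelled l n s lab z z ↔ l) : ∃ i, z = .inl i := by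
  rcases z with i | x
  · exact ⟨i, rfl⟩
  · exact (iff_not_self (hz.symm.trans (hs x))).elim

theorem exists_eq_inr_of_loop {z : Fin (n + 1) ⊕ W} (hz : labelled l n s lab z z ↔ ¬l) :
    ∃ x, z = .inr x := by
  rcases z with i | x
  · exact (ne_of_loop (chainRel_self i) hz rfl).elim
  · exact ⟨x, rfl⟩

theorem typeCount_labelled [Finite W] (l l' : Prop) (n : ℕ) (s : W → W → Prop)
    (lab : Bool → W → ℕ) :
    typeCount l' (labelled l n s lab) = typeCount l' (chainRel l n) + typeCount l' s := by
  rw [typeCount, typeCount, typeCount, ← Nat.card_sum]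
  exact Nat.card_congr (Equiv.subtypeSum (p := fun x => labelled l n s lab x x ↔ l'))

theorem chainOn_labelled (hs : ∀ x, s x x ↔ ¬l) : ChainOn l (labelled l n s lab) := by
  intro x y z hx hy hz hxy
  obtain ⟨x, rfl⟩ := exists_eq_inl_of_loop hs hx
  obtain ⟨y, rfl⟩ := exists_eq_inl_of_loop hs hy
  obtain ⟨z, rfl⟩ := exists_eq_inl_of_loop hs hz
  simpa only [labelled, ne_eq, Sum.inl.injEq] using
    chainOn_chainRel l n x y z hx hy hz (by simpa using hxy)

theorem degree_labelled (hs : ∀ x, s x x ↔ ¬l) {b : Bool} {x : W} (hlab : lab b x ≤ n + 1) :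
    degree b l (labelled l n s lab) (.inr x) = lab b x := by
  rw [degree, ← Nat.card_fin (lab b x)]
  refine (Nat.card_congr (Equiv.ofBijective
    (fun i : Fin (lab b x) => ⟨.inl (i.castLE hlab), chainRel_self _, arc_labelled.2 i.2⟩)
    ⟨fun i j hij => ?_, ?_⟩)).symm
  · simpa using hij
  · rintro ⟨z, hz, hxz⟩
    obtain ⟨i, rfl⟩ := exists_eq_inl_of_loop hs hz
    exact ⟨⟨i, arc_labelled.1 hxz⟩, rfl⟩

theorem hasLabel_mk_labelled [Finite W] (hs : ∀ x, s x x ↔ ¬l) (hlab : ∀ b x, lab b x ≤ n + 1)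
    {a b : ℕ} : HasLabel l (mk (labelled l n s lab)) (numeral a) (numeral b) ↔
      ∃ x, lab true x = a + 1 ∧ lab false x = b + 1 := by
  let e := (mkIso (labelled l n s lab)).symm
  have hdeg : ∀ c x, degree c l (mk (labelled l n s lab)).E (e (.inr x)) = lab c x := fun c x =>
    (degree_of_embedding e.toRelEmbedding (fun y _ => e.surjective y) _).trans
      (degree_labelled hs (hlab c x))
  rw [hasLabel_iff ((chainOn_labelled hs).of_embedding e.symm.toRelEmbedding)]
  constructor
  · rintro ⟨z, hz, ha, hb⟩
    obtain ⟨z, rfl⟩ := e.surjective z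
    obtain ⟨x, rfl⟩ := exists_eq_inr_of_loop (e.map_rel_iff.symm.trans hz)
    exact ⟨x, (hdeg _ _).symm.trans ha, (hdeg _ _).symm.trans hb⟩
  · rintro ⟨x, ha, hb⟩
    exact ⟨e (.inr x), loop_map e.toRelEmbedding (hs x), (hdeg _ _).trans ha, (hdeg _ _).trans hb⟩

end

/-! ### Counting the vertices with or without a loop -/

/-- `X` has more than `M` vertices that are not of type `l`: they can be numbered by the labels of
a digraph `Z` whose vertices not of type `l` form a substructure of `X`. -/
def CountGt (l : Prop) (X M : IsoType) : Prop :=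
  ∃ Z, ChainOn l Z.E ∧ (∀ W, (∀ x, W.E x x ↔ ¬l) → W ≤ Z → W ≤ X) ∧ ∀ J, J ≤ M → HasLabel l Z J J

section

variable {l : Prop} {X : IsoType} {m : ℕ}

theorem lt_typeCount_of_countGt (h : CountGt l X (numeral m)) : m < typeCount (¬l) X.E := by
  obtain ⟨Z, hZ, hW, hJ⟩ := h
  have hdeg : ∀ j : Fin (m + 1), ∃ z, (Z.E z z ↔ ¬l) ∧ degree true l Z.E z = j + 1 := fun j =>
    have ⟨z, hz, hd, _⟩ := (hasLabel_iff hZ).1 (hJ (numeral j) (chain_le_chain.2 (by omega)))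
    ⟨z, hz, hd⟩
  choose c hc hd using hdeg
  have : Nonempty {z // Z.E z z ↔ ¬l} := ⟨⟨c 0, hc 0⟩⟩
  have hZm : m < typeCount (¬l) Z.E := by
    have hle := Nat.card_le_card_of_injective
      (fun j => (⟨c j, hc j⟩ : {z // Z.E z z ↔ ¬l})) fun i j hij => by
        have := (hd i).symm.trans ((congrArg (degree true l Z.E) (Subtype.mk.inj hij)).trans (hd j))
        omega
    rwa [Nat.card_fin] at hle
  obtain ⟨e⟩ := mk_le.1 (hW (mk (Subrel Z.E fun z => Z.E z z ↔ ¬l))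
    (fun x => (mkIso _).map_rel_iff.symm.trans (mkIso _ x).2) (mk_subrel_le _ _))
  refine hZm.trans_le (le_of_eq_of_le ?_ (typeCount_le e (¬l)))
  exact (typeCount_eq_card fun x : {z // Z.E z z ↔ ¬l} => x.2).symm

theorem countGt_of_lt_typeCount (hm : m < typeCount (¬l) X.E) : CountGt l X (numeral m) := by
  have : Nonempty {x // X.E x x ↔ ¬l} := nonempty_subtype.2 (exists_of_typeCount_pos (by omega))
  let s := Subrel X.E fun x => X.E x x ↔ ¬l
  have hs : ∀ x, s x x ↔ ¬l := fun x => x.2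
  let q := Finite.equivFin {x // X.E x x ↔ ¬l}
  let k := typeCount (¬l) X.E
  refine ⟨mk (labelled l k s fun _ x => (q x : ℕ) + 1),
    (chainOn_labelled hs).of_embedding (mkIso _).toRelEmbedding, ?_, ?_⟩
  · intro W hW hle
    obtain ⟨e⟩ := le_mk.1 hle
    choose c hc using fun w => exists_eq_inr_of_loop (loop_map e (hW w))
    have hcs : ∀ {x y}, X.E (c x) (c y) ↔ W.E x y := fun {x y} => by
      rw [← e.map_rel_iff, hc, hc]
      rfl
    exact le_iff.2 ⟨⟨fun w => (c w).1, fun x y hxy =>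
      e.injective (by rw [hc, hc, Subtype.ext hxy])⟩, hcs⟩
  · intro J hJ
    obtain ⟨j, hj, rfl⟩ := le_chain_iff.1 hJ
    have hjk : j < k := hj.trans_lt hm
    rw [hasLabel_mk_labelled hs fun _ x => by
      have : (q x : ℕ) < k := (q x).2
      omega]
    exact ⟨q.symm ⟨j, hjk⟩, by simp⟩

theorem countGt_iff : CountGt l X (numeral m) ↔ m < typeCount (¬l) X.E :=
  ⟨lt_typeCount_of_countGt, countGt_of_lt_typeCount⟩

end

namespace OrderDefinable

open DefinablePred

variable {α : Type}

theorem forall_loop_iff (l : Prop) (i : α) : OrderDefinable fun v => ∀ x, (v i).E x x ↔ l :=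
  (forall_vertices (fun e _ => e 0 0 ↔ l) i).congr fun _ =>
    ⟨fun h x => h fun _ => x, fun h w => h (w 0)⟩

theorem chainOn (l : Prop) (i : α) : OrderDefinable fun v => ChainOn l (v i).E :=
  (forall_vertices (fun e d => (e 0 0 ↔ l) → (e 1 1 ↔ l) → (e 2 2 ↔ l) → ¬d 0 1 →
    (e 0 1 ↔ ¬e 1 0) ∧ (¬d 1 2 → e 0 1 → e 1 2 → e 0 2)) i).congr fun _ =>
    ⟨fun h x y z => h ![x, y, z, x], fun h w => h (w 0) (w 1) (w 2)⟩

theorem atMostOneOther (l : Prop) (i : α) : OrderDefinable fun v => AtMostOneOther l (v i).E :=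
  (forall_vertices (fun e d => (e 0 0 ↔ ¬l) → (e 1 1 ↔ ¬l) → d 0 1) i).congr fun _ =>
    ⟨fun h x y => h ![x, y, x, x], fun h w => h (w 0) (w 1)⟩

theorem fullyJoined (b : Bool) (l : Prop) (i : α) :
    OrderDefinable fun v => FullyJoined b l (v i).E :=
  ((forall_loop_iff l i).not.and (forall_vertices (fun e _ => (e 0 0 ↔ ¬l) → (e 1 1 ↔ l) →
    if b then e 0 1 else e 1 0) i)).congr fun _ =>
      and_congr (not_forall.trans (exists_congr fun _ => by tauto))
        ⟨fun h x y => h ![x, y, x, x], fun h w => h (w 0) (w 1)⟩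

theorem isChain (l : Prop) (i : α) : OrderDefinable fun v => ∃ n, v i = chain l n :=
  ((forall_loop_iff l i).and (chainOn l i)).congr fun _ => exists_eq_chain_iff.symm

theorem hasFullJoin (b : Bool) (l : Prop) (i j : α) :
    OrderDefinable fun v => HasFullJoin b l (v i) (v j) :=
  exists_elem (.and (le _ _) (.and (le _ _) (fullyJoined b l _)))

theorem hasLabel {l : Prop}
    (hl : ∀ {β : Type} (i j : β), OrderDefinable fun v => SameLength l (v i) (v j)) (i j k : α) :
    OrderDefinable fun v => HasLabel l (v i) (v j) (v k) :=
  exists_elem (.and (le _ _) (.and (atMostOneOther l _) (forall_elem (forall_elem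
    (.imp (hl _ _) (.and (.imp (le _ _) (le _ _))
      (.and (.iff (hasFullJoin _ _ _ _) (le _ _)) (.iff (hasFullJoin _ _ _ _) (le _ _)))))))))

theorem countGt {l : Prop}
    (hl : ∀ {β : Type} (i j : β), OrderDefinable fun v => SameLength l (v i) (v j)) (i j : α) :
    OrderDefinable fun v => CountGt l (v i) (v j) :=
  exists_elem (.and (chainOn l _)
    (.and (forall_elem (.imp (forall_loop_iff _ _) (.imp (le _ _) (le _ _))))
      (forall_elem (.imp (le _ _) (hasLabel hl _ _ _)))))

theorem sameLength_true (i j : α) : OrderDefinable fun v => SameLength True (v i) (v j) :=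
  ((isChain True i).and (eq i j)).congr fun _ =>
    ⟨fun ⟨⟨n, hn⟩, h⟩ => ⟨n, hn, h ▸ hn⟩, fun ⟨n, hi, hj⟩ => ⟨⟨n, hi⟩, hi.trans hj.symm⟩⟩

theorem sameLength_false (i j : α) : OrderDefinable fun v => SameLength False (v i) (v j) :=
  ((isChain True i).and ((isChain False j).and (forall_elem (p := fun v J =>
    (∃ n, J = numeral n) → (CountGt True (v j) J ↔ J ≤ v i))
    (.imp (isChain True _) (.iff (countGt sameLength_true _ _) (le _ _)))))).congr fun v => by
    have hcount : ∀ {k n}, CountGt True (chain False n) (numeral k) ↔ k < n + 1 := fun {k n} => by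
      rw [countGt_iff, not_true, typeCount_chain]
    constructor
    · rintro ⟨⟨m, hm⟩, ⟨n, hn⟩, h⟩
      have hlt : ∀ k, k < n + 1 ↔ k ≤ m := fun k => by
        simpa only [hm, hn, hcount, chain_le_chain] using h _ ⟨k, rfl⟩
      have := hlt m
      have := hlt n
      exact ⟨m, hm, hn.trans (chain_inj.2 (by omega))⟩
    · rintro ⟨m, hm, hn⟩
      refine ⟨⟨m, hm⟩, ⟨m, hn⟩, ?_⟩
      rintro _ ⟨k, rfl⟩
      rw [hm, hn, hcount, chain_le_chain, Nat.lt_succ_iff]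

theorem sameLength (l : Prop) (i j : α) : OrderDefinable fun v => SameLength l (v i) (v j) := by
  by_cases h : l
  · rw [eq_true h]
    exact sameLength_true i j
  · rw [eq_false h]
    exact sameLength_false i j

end OrderDefinable

/-! ### Codes of digraphs -/

/-- `R` codes the binary relation on `ℕ` that holds for `i` and `j` if some vertex of `R` without
a loop has the label `(i, j)`. -/
def Codes (R A B : IsoType) : Prop := HasLabel True R A B

/-- The digraph on `k + 1` vertices whose edge relation is coded by `S`. -/
noncomputable def decode (k : ℕ) (S : IsoType) : FinDigraph :=
  ⟨k, ⟨fun i j => Codes S (numeral i) (numeral j)⟩⟩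

/-- `K` and `S` are a code of `X`: `K` is the number `n` of vertices minus one, and `S` codes the
edge relation of a copy of `X` on `{0, …, n - 1}`. -/
def IsCodeOf (X K S : IsoType) : Prop := ∃ n, K = numeral n ∧ X = of (decode n S)

/-- The digraph with code `(K, S)` embeds into the one with code `(K', S')`. -/
def CodeEmbeds (K S K' S' : IsoType) : Prop :=
  ∃ F, (∀ i, i ≤ K → ∃ j, j ≤ K' ∧ Codes F i j) ∧ ∀ i, i ≤ K → ∀ j, j ≤ K' → ∀ i', i' ≤ K →
    ∀ j', j' ≤ K' → Codes F i j → Codes F i' j' →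
      ((i = i' ↔ j = j') ∧ (Codes S i i' ↔ Codes S' j j'))

/-- The digraph with code `(K, S)` has the pattern `t`. -/
def CodeHasPattern (t : Pattern) (K S : IsoType) : Prop :=
  ∃ w : Fin 4 → IsoType, (∀ a, w a ≤ K) ∧
    ∀ a b, (Codes S (w a) (w b) ↔ t.1 a b) ∧ (w a = w b ↔ t.2 a b)

/-- The digraph with code `(K, S)` has more than `m` vertices that are not of type `l`, where
`M = numeral m`: there is an injection of `{0, …, m}` into the set of these vertices. -/
def CodeCountGt (l : Prop) (K S M : IsoType) : Prop :=
  ∃ F, ∀ j, j ≤ M → ∃ i, i ≤ K ∧ (Codes S i i ↔ ¬l) ∧ Codes F j i ∧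
    ∀ j', j' ≤ M → Codes F j' i → j' = j

section Codes

variable {k k' m : ℕ} {l : Prop} {t : Pattern} {X S S' : IsoType} {p : IsoType → Prop}

theorem le_numeral_iff : X ≤ numeral k ↔ ∃ i : Fin (k + 1), X = numeral i := by
  rw [le_chain_iff]
  exact ⟨fun ⟨m, hm, h⟩ => ⟨⟨m, by omega⟩, h⟩, fun ⟨i, h⟩ => ⟨i, by omega, h⟩⟩

theorem forall_le_numeral : (∀ X, X ≤ numeral k → p X) ↔ ∀ i : Fin (k + 1), p (numeral i) := by
  simp only [le_numeral_iff]
  exact ⟨fun h i => h _ ⟨i, rfl⟩, by rintro h _ ⟨i, rfl⟩; exact h i⟩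

theorem exists_le_numeral : (∃ X, X ≤ numeral k ∧ p X) ↔ ∃ i : Fin (k + 1), p (numeral i) := by
  simp only [le_numeral_iff]
  exact ⟨fun ⟨_, ⟨i, rfl⟩, h⟩ => ⟨i, h⟩, fun ⟨i, h⟩ => ⟨_, ⟨i, rfl⟩, h⟩⟩

theorem numeral_inj {i j : Fin (k + 1)} : numeral i = numeral j ↔ i = j := by
  rw [chain_inj, Fin.val_inj]

theorem exists_codes (r : ℕ → ℕ → Prop) (N : ℕ) (h : ∀ i j, r i j → i ≤ N ∧ j ≤ N) :
    ∃ S, ∀ i j, Codes S (numeral i) (numeral j) ↔ r i j := by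
  let lab : Bool → {p : Fin (N + 1) × Fin (N + 1) // r p.1 p.2} → ℕ :=
    fun b x => (if b then (x.1.1 : ℕ) else x.1.2) + 1
  have hlab : ∀ b x, lab b x ≤ N + 1 := by
    rintro (_ | _) x <;> simp only [lab] <;> grind
  refine ⟨mk (labelled True N (fun _ _ => False) lab), fun i j => ?_⟩
  rw [Codes, hasLabel_mk_labelled (by simp) hlab]
  constructor
  · rintro ⟨⟨⟨a, b⟩, hab⟩, h₁, h₂⟩
    simp only [lab, if_true, Bool.false_eq_true, if_false, add_left_inj] at h₁ h₂
    rwa [← h₁, ← h₂]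
  · intro hij
    have := h i j hij
    exact ⟨⟨(⟨i, by omega⟩, ⟨j, by omega⟩), hij⟩, rfl, rfl⟩

theorem exists_codes_fin {m n : ℕ} (r : Fin (m + 1) → Fin (n + 1) → Prop) :
    ∃ S, ∀ (i : Fin (m + 1)) (j : Fin (n + 1)), Codes S (numeral i) (numeral j) ↔ r i j := by
  obtain ⟨S, hS⟩ := exists_codes
    (fun i j => ∃ (hi : i < m + 1) (hj : j < n + 1), r ⟨i, hi⟩ ⟨j, hj⟩) (m + n)
    fun i j ⟨hi, hj, _⟩ => ⟨by omega, by omega⟩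
  exact ⟨S, fun i j => (hS i j).trans ⟨fun ⟨_, _, h⟩ => h, fun h => ⟨i.2, j.2, h⟩⟩⟩

theorem decode_eq_iff {G : FinDigraph} {S : IsoType} :
    decode G.n S = G ↔ ∀ i j : G.V, Codes S (numeral i) (numeral j) ↔ G.E i j := by
  obtain ⟨n, ⟨r⟩⟩ := G
  simp only [decode, FinDigraph.mk.injEq, Digraph.mk.injEq, heq_eq_eq, true_and, funext_iff,
    eq_iff_iff]

theorem exists_decode_eq (G : FinDigraph) : ∃ S, decode G.n S = G :=
  (exists_codes_fin G.E).imp fun _ => decode_eq_iff.2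

theorem exists_isCodeOf (X : IsoType) : ∃ K S, IsCodeOf X K S := by
  obtain ⟨S, hS⟩ := exists_decode_eq (Quotient.out X)
  exact ⟨_, S, _, rfl, by rw [hS, of_out]⟩

theorem codeEmbeds_iff :
    CodeEmbeds (numeral k) S (numeral k') S' ↔ of (decode k S) ≤ of (decode k' S') := by
  simp only [CodeEmbeds, forall_le_numeral, exists_le_numeral, numeral_inj, of_le_of]
  constructor
  · rintro ⟨F, h₁, h₂⟩
    choose f hf using h₁
    exact ⟨⟨⟨f, fun i i' h => (h₂ _ _ _ _ (hf i) (hf i')).1.2 h⟩,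
      fun {i i'} => (h₂ _ _ _ _ (hf i) (hf i')).2.symm⟩⟩
  · rintro ⟨f⟩
    obtain ⟨F, hF⟩ := exists_codes_fin (m := k) (n := k') fun i j => f i = j
    refine ⟨F, fun i => ⟨f i, (hF _ _).2 rfl⟩, fun i j i' j' h h' => ?_⟩
    obtain rfl := (hF _ _).1 h
    obtain rfl := (hF _ _).1 h'
    exact ⟨f.injective.eq_iff.symm, f.map_rel_iff.symm⟩

theorem codeHasPattern_iff :
    CodeHasPattern t (numeral k) S ↔ HasPattern t (of (decode k S)).E := by
  rw [hasPattern_congr (ofIso _)]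
  constructor
  · rintro ⟨w, h₁, h₂⟩
    simp only [le_numeral_iff] at h₁
    choose u hu using h₁
    refine ⟨u, fun a b => ?_⟩
    have := h₂ a b
    rwa [hu, hu, numeral_inj] at this
  · rintro ⟨u, h⟩
    exact ⟨fun a => numeral (u a), fun a => le_numeral_iff.2 ⟨_, rfl⟩, fun a b => ⟨(h a b).1,
      numeral_inj.trans (h a b).2⟩⟩

theorem codeCountGt_iff :
    CodeCountGt l (numeral k) S (numeral m) ↔ m < typeCount (¬l) (of (decode k S)).E := by
  rw [typeCount_congr (ofIso _)]
  simp only [CodeCountGt, forall_le_numeral, exists_le_numeral, numeral_inj]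
  constructor
  · rintro ⟨F, h⟩
    choose f h₁ h₂ h₃ using h
    have := Nat.card_le_card_of_injective
      (fun j => (⟨f j, h₁ j⟩ : {x : (decode k S).V // (decode k S).E x x ↔ ¬l})) fun i j hij =>
        h₃ _ _ (by rw [← Subtype.mk.inj hij]; exact h₂ i)
    rwa [Nat.card_fin] at this
  · intro h
    let f : Fin (m + 1) → {x : (decode k S).V // (decode k S).E x x ↔ ¬l} :=
      fun j => (Finite.equivFin _).symm (j.castLE h)
    have hf : Function.Injective f :=
      (Equiv.injective _).comp (Fin.castLE_injective h)
    obtain ⟨F, hF⟩ := exists_codes_fin (m := m) (n := k) fun j i => (f j).1 = i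
    refine ⟨F, fun j => ⟨(f j).1, (f j).2, (hF j (f j).1).2 rfl, fun j' hj' => ?_⟩⟩
    exact hf (Subtype.ext ((hF j' (f j).1).1 hj'))

end Codes

namespace OrderDefinable

open DefinablePred

variable {α : Type}

theorem codes (i j k : α) : OrderDefinable fun v => Codes (v i) (v j) (v k) :=
  hasLabel (sameLength True) i j k

theorem codeEmbeds (i j k m : α) :
    OrderDefinable fun v => CodeEmbeds (v i) (v j) (v k) (v m) :=
  exists_elem (.and
    (forall_elem ((le _ _).imp (exists_elem ((le _ _).and (codes _ _ _)))))
    (forall_elem ((le _ _).imp (forall_elem ((le _ _).imp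
      (forall_elem ((le _ _).imp (forall_elem ((le _ _).imp
        ((codes _ _ _).imp ((codes _ _ _).imp
          (((eq _ _).iff (eq _ _)).and ((codes _ _ _).iff (codes _ _ _))))))))))))))

theorem codeHasPattern (t : Pattern) (i j : α) :
    OrderDefinable fun v => CodeHasPattern t (v i) (v j) :=
  exists_tuple (.and (forall_index fun _ => le _ _) (forall_index fun _ => forall_index fun _ =>
    ((codes _ _ _).iff (const _)).and ((eq _ _).iff (const _))))

theorem codeCountGt (l : Prop) (i j k : α) :
    OrderDefinable fun v => CodeCountGt l (v i) (v j) (v k) :=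
  exists_elem (forall_elem ((le _ _).imp (exists_elem ((le _ _).and
    (((codes _ _ _).iff (const _)).and ((codes _ _ _).and
      (forall_elem ((le _ _).imp ((codes _ _ _).imp (eq _ _))))))))))

end OrderDefinable

/-! ### Digraphs determined by what they look like -/

/-- `X` and `Y` look alike from `N`: they have the same patterns, the same numbers of vertices
with and without loops, and the same position with respect to the elements of `N`. -/
def Alike (N : Set IsoType) (X Y : IsoType) : Prop :=
  (∀ t, HasPattern t X.E ↔ HasPattern t Y.E) ∧ (∀ l, typeCount l X.E = typeCount l Y.E) ∧
    ∀ Z ∈ N, (X ≤ Z ↔ Y ≤ Z) ∧ (Z ≤ X ↔ Z ≤ Y)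

/-- The digraphs to which no other digraph looks alike from `N`. Passing from `N` to
`determined N` preserves `HasDefinableCodes`. -/
def determined (N : Set IsoType) : Set IsoType := {X | ∀ Y, Alike N X Y → X = Y}

/-- `X` looks like the digraph with code `(K, S)`. -/
def AlikeCode (N : Set IsoType) (X K S : IsoType) : Prop :=
  (∀ t, HasPattern t X.E ↔ CodeHasPattern t K S) ∧
    (∀ l M, (∃ n, M = numeral n) → (CountGt l X M ↔ CodeCountGt l K S M)) ∧
    ∀ Z K' S', Z ∈ N ∧ IsCodeOf Z K' S' →
      (X ≤ Z ↔ CodeEmbeds K S K' S') ∧ (Z ≤ X ↔ CodeEmbeds K' S' K S)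

/-- The relation between the elements of `N` and their codes is definable. -/
def HasDefinableCodes (N : Set IsoType) : Prop :=
  ∀ {α : Type} (i j k : α), OrderDefinable fun v => v i ∈ N ∧ IsCodeOf (v i) (v j) (v k)

theorem subset_determined (N : Set IsoType) : N ⊆ determined N := fun X hX _ h =>
  le_antisymm ((h.2.2 X hX).2.1 le_rfl) ((h.2.2 X hX).1.1 le_rfl)

theorem forall_countGt_iff {X : IsoType} {p : Prop → IsoType → Prop} {c : Prop → ℕ}
    (hp : ∀ l m, p l (numeral m) ↔ m < c (¬l)) :
    (∀ l M, (∃ n, M = numeral n) → (CountGt l X M ↔ p l M)) ↔ ∀ l, typeCount l X.E = c l := by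
  constructor
  · intro h l
    refine eq_of_forall_lt_iff fun m => ?_
    have := h (¬l) _ ⟨m, rfl⟩
    rwa [countGt_iff, hp, not_not] at this
  · rintro h l _ ⟨m, rfl⟩
    rw [countGt_iff, hp, h]

theorem alikeCode_iff {N : Set IsoType} {X S : IsoType} {n : ℕ} :
    AlikeCode N X (numeral n) S ↔ Alike N X (of (decode n S)) := by
  refine and_congr (forall_congr' fun t => iff_congr Iff.rfl codeHasPattern_iff)
    (and_congr (forall_countGt_iff fun _ _ => codeCountGt_iff) ⟨fun h Z hZ => ?_, ?_⟩)
  · obtain ⟨K, S', hS'⟩ := exists_isCodeOf Z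
    have hZS := h Z K S' ⟨hZ, hS'⟩
    obtain ⟨m, rfl, rfl⟩ := hS'
    rwa [codeEmbeds_iff, codeEmbeds_iff] at hZS
  · rintro h _ _ S' ⟨hZ, m, rfl, rfl⟩
    rw [codeEmbeds_iff, codeEmbeds_iff]
    exact h _ hZ

namespace HasDefinableCodes

open DefinablePred OrderDefinable

variable {N : Set IsoType} {α : Type}

theorem mem (h : HasDefinableCodes N) (i : α) : OrderDefinable fun v => v i ∈ N :=
  (exists_elem (p := fun v K => ∃ S, v i ∈ N ∧ IsCodeOf (v i) K S)
    (exists_elem (h _ _ _))).congr fun v =>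
      ⟨fun ⟨_, _, hN, _⟩ => hN, fun hN =>
        (exists_isCodeOf (v i)).imp fun _ ⟨S, hS⟩ => ⟨S, hN, hS⟩⟩

theorem alike (h : HasDefinableCodes N) (i j : α) :
    OrderDefinable fun v => Alike N (v i) (v j) := by
  refine .and (forall_index fun t => (hasPattern t i).iff (hasPattern t j))
    (.and (.congr (p := fun v => ∀ l M, (∃ n, M = numeral n) →
      (CountGt l (v i) M ↔ CountGt l (v j) M)) ?_
        fun _ => forall_countGt_iff fun _ _ => countGt_iff)
      (forall_elem ((h.mem _).imp (((le _ _).iff (le _ _)).and ((le _ _).iff (le _ _))))))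
  exact forall_index fun l => forall_elem ((isChain True _).imp
    ((countGt (sameLength l) _ _).iff (countGt (sameLength l) _ _)))

theorem alikeCode (h : HasDefinableCodes N) (i j k : α) :
    OrderDefinable fun v => AlikeCode N (v i) (v j) (v k) :=
  .and (forall_index fun t => (hasPattern t i).iff (codeHasPattern t j k))
    (.and (forall_index fun l => forall_elem ((isChain True _).imp
      ((countGt (sameLength l) _ _).iff (codeCountGt l _ _ _))))
      (forall_elem (forall_elem (forall_elem ((h _ _ _).imp
        (((le _ _).iff (codeEmbeds _ _ _ _)).and ((le _ _).iff (codeEmbeds _ _ _ _))))))))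

protected theorem determined (h : HasDefinableCodes N) : HasDefinableCodes (determined N) := by
  intro α i j k
  have hdef : OrderDefinable fun v : α → IsoType => v i ∈ determined N ∧
      (∃ n, v j = numeral n) ∧ AlikeCode N (v i) (v j) (v k) :=
    (forall_elem ((h.alike _ _).imp (eq _ _))).and
      ((isChain True j).and (h.alikeCode i j k))
  refine hdef.congr fun v => and_congr_right fun hX => ?_
  constructor
  · rintro ⟨⟨n, hn⟩, halike⟩
    rw [hn, alikeCode_iff] at halike
    exact ⟨n, hn, hX _ halike⟩
  · rintro ⟨n, hn, hXn⟩
    rw [hn, alikeCode_iff, ← hXn]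
    exact ⟨⟨n, rfl⟩, fun _ => Iff.rfl, fun _ => rfl, fun _ _ => ⟨Iff.rfl, Iff.rfl⟩⟩

end HasDefinableCodes

/-- The chains, where the iteration of `determined` starts. -/
def chains : Set IsoType := {X | ∃ l n, X = chain l n}

theorem card_V_of (G : FinDigraph) : Nat.card (of G).V = G.n + 1 :=
  (Nat.card_congr (ofIso G).toEquiv).trans (Nat.card_fin _)

theorem card_V_chain (l : Prop) (n : ℕ) : Nat.card (chain l n).V = n + 1 :=
  (Nat.card_congr (mkIso _).toEquiv).trans (Nat.card_fin _)

theorem eq_chain_of_hasPattern {X : IsoType} {l : Prop} {n : ℕ}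
    (h : ∀ t, HasPattern t X.E → HasPattern t (chain l n).E) :
    X = chain l (Nat.card X.V - 1) := by
  have key : ∀ w : Fin 4 → X.V, ∃ w' : Fin 4 → (chain l n).V, ∀ a b,
      ((chain l n).E (w' a) (w' b) ↔ X.E (w a) (w b)) ∧ (w' a = w' b ↔ w a = w b) := fun w =>
    h _ (hasPattern_self X.E w)
  have hloop : ∀ x, X.E x x ↔ l := fun x => by
    obtain ⟨w', hw'⟩ := key fun _ => x
    rw [← (hw' 0 0).1]
    exact loop_chain l n _
  refine eq_chain hloop fun x y z _ _ _ hxy => ?_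
  obtain ⟨w', hw'⟩ := key ![x, y, z, x]
  have := chainOn_chain l n (w' 0) (w' 1) (w' 2) (loop_chain _ _ _) (loop_chain _ _ _)
    (loop_chain _ _ _) fun h => hxy ((hw' 0 1).2.1 h)
  rwa [(hw' 0 1).1, (hw' 1 0).1, (hw' 1 2).1, (hw' 0 2).1, ne_eq, (hw' 1 2).2] at this

open DefinablePred OrderDefinable in
theorem hasDefinableCodes_chains : HasDefinableCodes chains := by
  intro α i j k
  have hdef : OrderDefinable fun v : α → IsoType => ∃ l, SameLength l (v j) (v i) ∧
      ∀ t, CodeHasPattern t (v j) (v k) → HasPattern t (v i).E :=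
    exists_index fun l => (sameLength l j i).and
      (forall_index fun t => (codeHasPattern t j k).imp (hasPattern t i))
  refine hdef.congr fun v => ?_
  constructor
  · rintro ⟨l, ⟨n, hj, hi⟩, hpat⟩
    simp only [hj, codeHasPattern_iff] at hpat
    rw [hi] at hpat
    refine ⟨⟨l, n, hi⟩, n, hj, ?_⟩
    rw [hi, eq_chain_of_hasPattern hpat, card_V_of]
    rfl
  · rintro ⟨⟨l, m, hi⟩, n, hj, hX⟩
    have hmn : m = n := by
      have := card_V_chain l m
      rw [← hi, hX, card_V_of] at this
      exact (Nat.succ_injective this).symm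
    refine ⟨l, ⟨n, hj, hmn ▸ hi⟩, fun t ht => ?_⟩
    rwa [hj, codeHasPattern_iff, ← hX] at ht

/-! ### Consequences of being alike -/

theorem exists_factor {U V W : Type} {t : U → U → Prop} {r : V → V → Prop} {q : W → W → Prop}
    (j : r ↪r q) (e : t ↪r q) (h : ∀ y, ∃ x, j x = e y) : ∃ k : t ↪r r, ∀ y, j (k y) = e y := by
  choose k hk using h
  refine ⟨⟨⟨k, fun a b hab => e.injective (by rw [← hk, ← hk, hab])⟩, fun {a b} => ?_⟩, hk⟩
  rw [← e.map_rel_iff, ← hk, ← hk, j.map_rel_iff]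
  rfl

namespace Alike

variable {N : Set IsoType} {V W : Type} [Finite V] [Nonempty V]
  {r : V → V → Prop} {q : W → W → Prop} {Y : IsoType}

theorem typeCount_eq (h : Alike N (mk r) Y) (l : Prop) : typeCount l Y.E = typeCount l r := by
  rw [← h.2.1 l, typeCount_mk]

theorem card_eq (h : Alike N (mk r) Y) : Nat.card Y.V = Nat.card V := by
  rw [card_eq_typeCount_add Y.E True, card_eq_typeCount_add r True, h.typeCount_eq, h.typeCount_eq]

theorem eq_of_embedding (h : Alike N (mk r) Y) (e : r ↪r Y.E) : mk r = Y :=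
  eq_of_le_of_typeCount_le (mk_le.2 ⟨e⟩) fun l => (h.2.1 l).ge

theorem eq_of_factor (h : Alike N (mk r) Y) (j : r ↪r q) (e : Y.E ↪r q)
    (hj : ∀ y, ∃ x, j x = e y) : mk r = Y := by
  obtain ⟨k, -⟩ := exists_factor j e hj
  exact (eq_of_le_of_typeCount_le (le_mk.2 ⟨k⟩) fun l => (h.2.1 l).le).symm

theorem exists_image (h : Alike N (mk r) Y) (w : Fin 4 → V) : ∃ w' : Fin 4 → Y.V,
    ∀ a b, (Y.E (w' a) (w' b) ↔ r (w a) (w b)) ∧ (w' a = w' b ↔ w a = w b) :=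
  (h.1 _).1 ((hasPattern_congr (mkIso r)).2 (hasPattern_self r w))

theorem exists_preimage (h : Alike N (mk r) Y) (w : Fin 4 → Y.V) : ∃ w' : Fin 4 → V,
    ∀ a b, (r (w' a) (w' b) ↔ Y.E (w a) (w b)) ∧ (w' a = w' b ↔ w a = w b) :=
  (hasPattern_congr (mkIso r)).1 ((h.1 _).2 (hasPattern_self Y.E w))

variable [Finite W] [Nonempty W]

theorem embedding (h : Alike N (mk r) Y) (hq : mk q ∈ N) (e : q ↪r r) : Nonempty (q ↪r Y.E) :=
  mk_le.1 ((h.2.2 _ hq).2.1 (mk_le_mk.2 ⟨e⟩))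

theorem embedding_into (h : Alike N (mk r) Y) (hq : mk q ∈ N) (e : r ↪r q) :
    Nonempty (Y.E ↪r q) :=
  le_mk.1 ((h.2.2 _ hq).1.1 (mk_le_mk.2 ⟨e⟩))

end Alike

/-- The digraphs recognized after `i` rounds of `determined`, starting from the chains. -/
def stage : ℕ → Set IsoType
  | 0 => chains
  | i + 1 => determined (stage i)

theorem stage_mono : Monotone stage := monotone_nat_of_le_succ fun _ => subset_determined _

theorem mem_stage_succ {i : ℕ} {X : IsoType} :
    X ∈ stage (i + 1) ↔ ∀ Y, Alike (stage i) X Y → X = Y := Iff.rfl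

theorem Alike.exists_chain {i n : ℕ} {l : Prop} {V : Type} [Finite V] [Nonempty V]
    {r : V → V → Prop} {Y : IsoType} (h : Alike (stage i) (mk r) Y) (e : chainRel l n ↪r r) :
    Nonempty (chainRel l n ↪r Y.E) :=
  h.embedding (stage_mono (Nat.zero_le i) ⟨l, n, rfl⟩) e

/-! ### Marked digraphs -/

/-- The vertex `y` is joined, in both directions, to the first `p` vertices of the chain `f` and to
no others. -/
def HasMark {V : Type} (r : V → V → Prop) {n : ℕ} (f : Fin (n + 1) → V) (y : V) (p : ℕ) : Prop :=
  ∀ i, (r y (f i) ↔ i < p) ∧ (r (f i) y ↔ i < p)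

/-- The digraph `s` next to a chain, where a vertex `x` of `s` has the mark `p x`. -/
abbrev marked (l : Prop) (n : ℕ) {W : Type} (s : W → W → Prop) (p : W → ℕ) :
    Fin (n + 1) ⊕ W → Fin (n + 1) ⊕ W → Prop :=
  labelled l n s fun _ => p

/-- The numbers `p x` can be told apart as marks over a chain of `n + 1` vertices. -/
structure IsMarking (n : ℕ) {W : Type} (p : W → ℕ) : Prop where
  injective : Function.Injective p
  le (x : W) : p x ≤ n + 1

section

variable {l : Prop} {n : ℕ} {V W B : Type} {r : V → V → Prop} {s : W → W → Prop} {p : W → ℕ}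

theorem HasMark.unique {f : Fin (n + 1) → V} {y : V} {a b : ℕ} (ha : HasMark r f y a)
    (hb : HasMark r f y b) (han : a ≤ n + 1) (hbn : b ≤ n + 1) : a = b := by
  have hiff : ∀ i (_ : i < n + 1), i < a ↔ i < b := fun i hi =>
    (ha ⟨i, hi⟩).1.symm.trans (hb ⟨i, hi⟩).1
  by_contra hne
  rcases Ne.lt_or_gt hne with hlt | hlt
  · exact lt_irrefl a ((hiff a (by omega)).2 hlt)
  · exact lt_irrefl b ((hiff b (by omega)).1 hlt)

theorem hasMark_of_marked_embedding (e : marked l n s p ↪r r) (x : W) :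
    HasMark r (fun i => e (.inl i)) (e (.inr x)) (p x) :=
  fun _ => ⟨e.map_rel_iff, e.map_rel_iff⟩

theorem IsMarking.comp (hp : IsMarking n p) {g : B → W} (hg : Function.Injective g) :
    IsMarking n fun b => p (g b) :=
  ⟨hp.injective.comp hg, fun b => hp.le (g b)⟩

theorem IsMarking.option (hp : IsMarking n p) {c : ℕ} (hcn : c ≤ n + 1) (hc : ∀ x, p x ≠ c) :
    IsMarking n fun x : Option W => x.elim c p where
  injective := by
    rintro (_ | x) (_ | x') h
    · rfl
    · exact (hc x' h.symm).elim
    · exact (hc x h).elim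
    · rw [hp.injective h]
  le := by
    rintro (_ | x)
    · exact hcn
    · exact hp.le x

theorem exists_pos_marking (V : Type) [Finite V] :
    ∃ p : V → ℕ, Function.Injective p ∧ ∀ x, 0 < p x ∧ p x ≤ Nat.card V := by
  let q := Finite.equivFin V
  exact ⟨fun x => q x + 1, fun x x' h => q.injective (Fin.ext (Nat.succ_injective h)),
    fun x => ⟨Nat.succ_pos _, (q x).2⟩⟩

/-- The embedding of a marked digraph with given values on the chain and on the marked vertices. -/
def markedEmbedding (f : chainRel l n ↪r r) (y : W → V) (hy : Function.Injective y)
    (hfy : ∀ i x, f i ≠ y x) (hmark : ∀ x, HasMark r f (y x) (p x))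
    (hs : ∀ x x', r (y x) (y x') ↔ s x x') : marked l n s p ↪r r :=
  ⟨⟨Sum.elim f y, f.injective.sumElim hy hfy⟩, by
    rintro (i | x) (j | x')
    · exact f.map_rel_iff
    · exact (hmark x' i).2
    · exact (hmark x j).1
    · exact hs x x'⟩

end

/-! ### One marked vertex -/

/-- A chain of `n + 1` vertices of type `l` and one further vertex, with the mark `p`. -/
abbrev pointed (l : Prop) (n p : ℕ) : Fin (n + 1) ⊕ Unit → Fin (n + 1) ⊕ Unit → Prop :=
  marked l n (fun _ _ : Unit => ¬l) fun _ => p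

section

variable {N : Set IsoType} {l : Prop} {i n p k : ℕ} {V W : Type} {r : V → V → Prop}
  {s : W → W → Prop} {Y : IsoType}

/-- The embedding of a pointed chain with given values on the chain and on the marked vertex. -/
def pointedEmbedding (f : chainRel l n ↪r r) {y : V} (hy : r y y ↔ ¬l) (hmark : HasMark r f y p) :
    pointed l n p ↪r r :=
  markedEmbedding f (fun _ => y) (Function.injective_of_subsingleton _)
    (fun i _ => ne_of_loop (loop_map f (chainRel_self i)) hy) (fun _ => hmark) fun _ _ => hy

/-- A marked vertex that is not of type `l`, together with the chain. -/
def pointedMarked {p : W → ℕ} {x : W} (hx : s x x ↔ ¬l) :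
    pointed l n (p x) ↪r marked l n s p :=
  pointedEmbedding (labelledChain l n s _) (y := .inr x) hx fun _ => ⟨Iff.rfl, Iff.rfl⟩

theorem typeCount_pointed (l l' : Prop) (n p : ℕ) :
    typeCount l' (pointed l n p) =
      typeCount l' (chainRel l n) + typeCount l' (fun _ _ : Unit => ¬l) :=
  typeCount_labelled l l' n _ _

theorem typeCount_not_pointed (l : Prop) (n p : ℕ) : typeCount (¬l) (pointed l n p) = 1 := by
  rw [typeCount_pointed, typeCount_not_chainRel, zero_add, typeCount_eq_card fun _ => Iff.rfl,
    Nat.card_unique]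

theorem pointed_le_pointed_iff (hk : k ≤ n + 1) :
    mk (pointed l i (i + 1)) ≤ mk (pointed l n k) ↔ i + 1 ≤ k := by
  rw [mk_le_mk]
  constructor
  · rintro ⟨e⟩
    obtain ⟨⟨⟩, hx⟩ := exists_eq_inr_of_loop (loop_map e (x := .inr ()) (l := ¬l) Iff.rfl)
    choose c hc using fun j : Fin (i + 1) => exists_eq_inl_of_loop (fun _ => Iff.rfl)
      (loop_map e (x := .inl j) (chainRel_self j))
    have hlt : ∀ j, (c j : ℕ) < k := fun j => by
      have hedge : pointed l n k (e (.inr ())) (e (.inl j)) := e.map_rel_iff.2 j.2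
      rwa [hx, hc] at hedge
    have hcard := Fintype.card_le_of_injective (fun j => (⟨c j, hlt j⟩ : Fin k)) fun a b hab =>
      Sum.inl_injective (e.injective (by rw [hc, hc, Fin.ext (Fin.mk.inj hab)]))
    rwa [Fintype.card_fin, Fintype.card_fin] at hcard
  · intro h
    refine ⟨pointedEmbedding ((initialSegment l (by omega)).trans (labelledChain l n _ _))
      (y := .inr ()) Iff.rfl fun j => ?_⟩
    have hj : (j : ℕ) < k ↔ (j : ℕ) < i + 1 := by omega
    exact ⟨hj, hj⟩

theorem exists_mem_iff_lt {S : Set (Fin (n + 1))} (hS : IsLowerSet S) :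
    ∃ k ≤ n + 1, ∀ i : Fin (n + 1), i ∈ S ↔ (i : ℕ) < k := by
  rcases hS.eq_univ_or_Iio with rfl | ⟨a, rfl⟩
  · exact ⟨n + 1, le_rfl, fun i => iff_of_true trivial i.2⟩
  · exact ⟨a, a.2.le, fun i => Fin.lt_def⟩

namespace Alike

theorem exists_chain_and_point (h : Alike (stage i) (mk (pointed l n p)) Y) :
    ∃ (_ : chainRel l n ↪r Y.E) (y : Y.V), Y.E y y ↔ ¬l := by
  obtain ⟨f⟩ := h.exists_chain (labelledChain l n _ _)
  have hcount : typeCount (¬l) Y.E = 1 := by rw [h.typeCount_eq, typeCount_not_pointed]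
  exact ⟨f, exists_of_typeCount_pos (hcount ▸ Nat.one_pos)⟩

theorem exists_lt_mark_iff (h : Alike N (mk (pointed l n p)) Y) (f : chainRel l n ↪r Y.E)
    {y : Y.V} (hy : Y.E y y ↔ ¬l) (j j' : Fin (n + 1)) : ∃ b c : Fin (n + 1),
      (Y.E y (f j) ↔ b < p) ∧ (Y.E (f j) y ↔ b < p) ∧ (Y.E y (f j') ↔ c < p) ∧
        (chainRel l n c b ↔ chainRel l n j' j) := by
  obtain ⟨w, hw⟩ := h.exists_preimage ![y, f j, f j', y]
  obtain ⟨a, ha⟩ := exists_eq_inr_of_loop ((hw 0 0).1.trans hy)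
  obtain ⟨b, hb⟩ := exists_eq_inl_of_loop (fun _ => Iff.rfl)
    ((hw 1 1).1.trans (loop_map f (chainRel_self j)))
  obtain ⟨c, hc⟩ := exists_eq_inl_of_loop (fun _ => Iff.rfl)
    ((hw 2 2).1.trans (loop_map f (chainRel_self j')))
  have hyj := (hw 0 1).1
  have hjy := (hw 1 0).1
  have hyj' := (hw 0 2).1
  have hjj' := (hw 2 1).1
  rw [ha, hb] at hyj hjy
  rw [ha, hc] at hyj'
  rw [hb, hc] at hjj'
  exact ⟨b, c, hyj.symm, hjy.symm, hyj'.symm, hjj'.trans f.map_rel_iff⟩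

theorem exists_hasMark (h : Alike N (mk (pointed l n p)) Y) (f : chainRel l n ↪r Y.E)
    {y : Y.V} (hy : Y.E y y ↔ ¬l) : ∃ k ≤ n + 1, HasMark Y.E f y k := by
  have hlower : IsLowerSet {j | Y.E y (f j)} := fun j j' hle hj => by
    obtain rfl | hlt := hle.eq_or_lt
    · exact hj
    obtain ⟨b, c, hyj, -, hyj', hcb⟩ := h.exists_lt_mark_iff f hy j j'
    have hle : c ≤ b := (hcb.2 (.inl hlt)).elim (·.le) (·.1.le)
    exact hyj'.2 (lt_of_le_of_lt hle (hyj.1 hj))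
  obtain ⟨k, hkn, hk⟩ := exists_mem_iff_lt hlower
  refine ⟨k, hkn, fun j => ⟨hk j, ?_⟩⟩
  obtain ⟨b, -, hyj, hjy, -⟩ := h.exists_lt_mark_iff f hy j j
  exact (hjy.trans hyj.symm).trans (hk j)

end Alike

theorem mk_pointed_succ_mem_stage (l : Prop) (n : ℕ) : mk (pointed l n (n + 1)) ∈ stage 1 :=
  mem_stage_succ.2 fun Y h => by
    obtain ⟨f, y, hy⟩ := h.exists_chain_and_point
    refine h.eq_of_embedding (pointedEmbedding f hy fun j => ?_)
    obtain ⟨b, -, hyj, hjy, -⟩ := h.exists_lt_mark_iff f hy j j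
    exact ⟨iff_of_true (hyj.2 b.2) j.2, iff_of_true (hjy.2 b.2) j.2⟩

theorem mk_pointed_mem_stage (l : Prop) (hp : p ≤ n + 1) : mk (pointed l n p) ∈ stage 2 :=
  mem_stage_succ.2 fun Y h => by
    obtain ⟨f, y, hy⟩ := h.exists_chain_and_point
    obtain ⟨k, hk, hmark⟩ := h.exists_hasMark f hy
    have hY : mk (pointed l n k) = Y :=
      eq_of_le_of_typeCount_le (mk_le.2 ⟨pointedEmbedding f hy hmark⟩) fun l' => by
        rw [h.typeCount_eq, typeCount_mk, typeCount_pointed, typeCount_pointed]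
    have hpk : ∀ i, i + 1 ≤ p ↔ i + 1 ≤ k := fun i => by
      rw [← pointed_le_pointed_iff hp, ← pointed_le_pointed_iff hk, hY]
      exact (h.2.2 _ (mk_pointed_succ_mem_stage l i)).2
    have hpk' : p = k := by
      have := hpk (p - 1)
      have := hpk (k - 1)
      omega
    rw [← hY, hpk']

end

/-! ### Skeletons -/

/-- The digraph `r` consists of its only chain `f` of `n + 1` vertices of type `l` and of vertices
`y x` with the marks `p x`. So `r` is a marked digraph up to the edges between the `y x`. -/
structure IsSkeleton {l : Prop} {n : ℕ} {V W : Type} {r : V → V → Prop} (f : chainRel l n ↪r r)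
    (y : W → V) (p : W → ℕ) : Prop where
  eq_chain (k : chainRel l n ↪r r) (i : Fin (n + 1)) : k i = f i
  cover (z : V) : (∃ i, f i = z) ∨ ∃ x, y x = z
  ne (i : Fin (n + 1)) (x : W) : f i ≠ y x
  hasMark (x : W) : HasMark r f (y x) (p x)

section

variable {l : Prop} {n : ℕ} {V W B : Type} {r : V → V → Prop} {f : chainRel l n ↪r r} {y : W → V}
  {p : W → ℕ} {s : W → W → Prop} {s' : B → B → Prop}

theorem hasMark_of_eq_chain (hf : ∀ k : chainRel l n ↪r r, ∀ i, k i = f i)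
    (e : marked l n s p ↪r r) (x : W) :
    (∀ i, f i ≠ e (.inr x)) ∧ HasMark r f (e (.inr x)) (p x) := by
  have hef : (fun i => e (.inl i)) = f := funext (hf ((labelledChain l n s _).trans e))
  rw [← hef]
  exact ⟨fun _ => e.injective.ne Sum.inl_ne_inr, hasMark_of_marked_embedding e x⟩

theorem IsMarking.exists_isSkeleton [Finite V] [Finite W] (hp : IsMarking n p)
    (hf : ∀ k : chainRel l n ↪r r, ∀ i, k i = f i)
    (hv : ∀ x, ∃ v, (∀ i, f i ≠ v) ∧ HasMark r f v (p x))
    (hcard : Nat.card V ≤ Nat.card (Fin (n + 1) ⊕ W)) : ∃ y, IsSkeleton f y p := by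
  choose y hfy hmark using hv
  have hy : Function.Injective y := fun x x' hxx =>
    hp.injective ((hmark x).unique (hxx ▸ hmark x') (hp.le x) (hp.le x'))
  have hinj := f.injective.sumElim hy fun i x => hfy x i
  have hsurj := (hinj.bijective_of_nat_card_le hcard).surjective
  exact ⟨y, hf, fun z => Sum.exists.1 (hsurj z), fun i x => hfy x i, hmark⟩

namespace IsSkeleton

theorem injective (h : IsSkeleton f y p) (hp : IsMarking n p) : Function.Injective y :=
  fun x x' hxx => hp.injective
    ((h.hasMark x).unique (hxx ▸ h.hasMark x') (hp.le x) (hp.le x'))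

/-- The embedding that the skeleton defines once the edges between the marked vertices are known. -/
def embedding (h : IsSkeleton f y p) (hp : IsMarking n p)
    (hs : ∀ x x', r (y x) (y x') ↔ s x x') : marked l n s p ↪r r :=
  markedEmbedding f y (h.injective hp) h.ne h.hasMark hs

theorem apply_inr (h : IsSkeleton f y p) (hp : IsMarking n p) {g : B → W}
    (e : marked l n s' (fun b => p (g b)) ↪r r) (b : B) : e (.inr b) = y (g b) := by
  obtain ⟨hne, hmark⟩ := hasMark_of_eq_chain h.eq_chain e b
  obtain ⟨i, hi⟩ | ⟨x, hx⟩ := h.cover (e (.inr b))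
  · exact (hne i hi).elim
  · rw [← hx] at hmark
    rw [← hx, hp.injective ((h.hasMark x).unique hmark (hp.le _) (hp.le _))]

theorem rel_iff (h : IsSkeleton f y p) (hp : IsMarking n p) {g : B → W}
    (e : marked l n s' (fun b => p (g b)) ↪r r) (a b : B) :
    r (y (g a)) (y (g b)) ↔ s' a b := by
  rw [← h.apply_inr hp e, ← h.apply_inr hp e]
  exact e.map_rel_iff

theorem exists_of_loop_iff_not (h : IsSkeleton f y p) {z : V} (hz : r z z ↔ ¬l) :
    ∃ x, y x = z := by
  refine (h.cover z).resolve_left ?_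
  rintro ⟨i, rfl⟩
  exact ne_of_loop (loop_map f (chainRel_self i)) hz rfl

end IsSkeleton

end

/-- The function with the values `x` and `x'`, used to restrict digraphs to two vertices. -/
def pair {W : Type} {x x' : W} (h : x ≠ x') : Bool ↪ W :=
  ⟨fun b => bif b then x' else x, by rintro (_ | _) (_ | _) hb <;> simp_all⟩

/-! ### Marked vertices without a vertex of type `l` -/

section

variable {l : Prop} {i n : ℕ} {W : Type} [Finite W] {s : W → W → Prop} {p : W → ℕ} {Y : IsoType}

theorem Alike.exists_isSkeleton_of_loop_iff_not (h : Alike (stage i) (mk (marked l n s p)) Y)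
    (hi : 2 ≤ i) (hs : ∀ x, s x x ↔ ¬l) (hp : IsMarking n p) :
    ∃ (f : chainRel l n ↪r Y.E) (y : W → Y.V),
      IsSkeleton f y p ∧ ∀ x, Y.E (y x) (y x) ↔ ¬l := by
  obtain ⟨f⟩ := h.exists_chain (labelledChain l n _ _)
  have hcount : typeCount l s = 0 := by
    simpa only [not_not] using typeCount_not_eq_zero hs
  have hcover : ∀ z, (Y.E z z ↔ l) → ∃ j, f j = z := fun z hz =>
    exists_apply_eq_of_typeCount_le f
      (by rw [h.typeCount_eq, typeCount_labelled, hcount, add_zero]) hz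
  have hf : ∀ k : chainRel l n ↪r Y.E, ∀ j, k j = f j := fun k =>
    apply_eq_of_same_range k f fun j => hcover _ (loop_map k (chainRel_self j))
  obtain ⟨y, hy⟩ := hp.exists_isSkeleton hf (fun x => by
    obtain ⟨e⟩ := h.embedding (stage_mono hi (mk_pointed_mem_stage l (hp.le x)))
      (pointedMarked (hs x))
    exact ⟨_, hasMark_of_eq_chain hf e ()⟩) h.card_eq.le
  refine ⟨f, y, hy, fun x => (iff_or_iff_not _ l).resolve_left fun hx => ?_⟩
  obtain ⟨j, hj⟩ := hcover _ hx
  exact hy.ne j x hj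

theorem mk_marked_bool_mem_stage {s : Bool → Bool → Prop} {p : Bool → ℕ} (hs : ∀ x, s x x ↔ ¬l)
    (hlt : p false < p true) (hle : p true ≤ n + 1) : mk (marked l n s p) ∈ stage 3 :=
  mem_stage_succ.2 fun Y h => by
    have hp : IsMarking n p := by
      refine ⟨?_, ?_⟩
      · rintro (_ | _) (_ | _) hxy <;> simp_all
      · rintro (_ | _) <;> omega
    obtain ⟨f, y, hY, hy⟩ := h.exists_isSkeleton_of_loop_iff_not le_rfl hs hp
    obtain ⟨w, hw⟩ := h.exists_image
      ![.inr false, .inr true, .inl ⟨p false, by omega⟩, .inr true]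
    obtain ⟨a, ha⟩ := hY.exists_of_loop_iff_not ((hw 0 0).1.trans (hs false))
    obtain ⟨b, hb⟩ := hY.exists_of_loop_iff_not ((hw 1 1).1.trans (hs true))
    obtain ⟨i, hi⟩ : ∃ i, f i = w 2 := (hY.cover (w 2)).resolve_right fun ⟨x, hx⟩ =>
      ne_of_loop ((hw 2 2).1.trans (chainRel_self _)) (hx ▸ hy x) rfl
    have hai : ¬(i : ℕ) < p a := by
      rw [← (hY.hasMark a i).1, ha, hi, (hw 0 2).1]
      exact lt_irrefl _
    have hbi : (i : ℕ) < p b := by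
      rw [← (hY.hasMark b i).1, hb, hi, (hw 1 2).1]
      exact hlt
    obtain ⟨rfl, rfl⟩ : a = false ∧ b = true := by
      rcases a with _ | _ <;> rcases b with _ | _ <;> first | omega | exact ⟨rfl, rfl⟩
    refine h.eq_of_embedding (hY.embedding hp ?_)
    rintro (_ | _) (_ | _)
    · exact (hy false).trans (hs false).symm
    · rw [ha, hb]
      exact (hw 0 1).1
    · rw [ha, hb]
      exact (hw 1 0).1
    · exact (hy true).trans (hs true).symm

theorem mk_marked_mem_stage_of_loop_iff_not (hs : ∀ x, s x x ↔ ¬l) (hp : IsMarking n p) :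
    mk (marked l n s p) ∈ stage 4 :=
  mem_stage_succ.2 fun Y h => by
    obtain ⟨f, y, hY, hy⟩ := h.exists_isSkeleton_of_loop_iff_not (by omega) hs hp
    have hpair : ∀ x x', p x < p x' →
        (Y.E (y x) (y x') ↔ s x x') ∧ (Y.E (y x') (y x) ↔ s x' x) := fun x x' hlt => by
      have hne : x ≠ x' := fun hxx => hlt.ne (congrArg p hxx)
      obtain ⟨e⟩ := h.embedding (mk_marked_bool_mem_stage (fun b => hs _) hlt (hp.le x'))
        (labelledMap l n (.preimage (pair hne) s) fun _ => p)
      exact ⟨hY.rel_iff hp e false true, hY.rel_iff hp e true false⟩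
    refine h.eq_of_embedding (hY.embedding hp fun x x' => ?_)
    rcases lt_trichotomy (p x) (p x') with hlt | heq | hlt
    · exact (hpair x x' hlt).1
    · rw [hp.injective heq, hy, hs]
    · exact (hpair x' x hlt).2

theorem mk_mem_stage_of_loop_iff [Nonempty W] (hs : ∀ x, s x x ↔ l) : mk s ∈ stage 5 :=
  mem_stage_succ.2 fun Y h => by
    obtain ⟨p, hp, hpW⟩ := exists_pos_marking W
    have hs' : ∀ x, s x x ↔ ¬¬l := by simpa only [not_not] using hs
    have hp' : IsMarking (Nat.card W) p := ⟨hp, fun x => (hpW x).2.trans (Nat.le_succ _)⟩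
    let j := labelledVertices (¬l) (Nat.card W) s fun _ => p
    obtain ⟨e⟩ := h.embedding_into (mk_marked_mem_stage_of_loop_iff_not hs' hp') j
    have hY : ∀ y, Y.E y y ↔ l := fun y => (iff_or_iff_not _ l).resolve_right fun hy => by
      have hpos : 0 < typeCount (¬l) Y.E := Nat.card_pos_iff.2 ⟨⟨⟨y, hy⟩⟩, inferInstance⟩
      rw [h.typeCount_eq, typeCount_not_eq_zero hs] at hpos
      exact lt_irrefl 0 hpos
    exact h.eq_of_factor j e fun y => (exists_eq_inr_of_loop
      (loop_map e ((hY y).trans not_not.symm))).imp fun _ => Eq.symm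

end

/-! ### Recognizing marked digraphs -/

section

variable {l : Prop} {i n : ℕ} {V W : Type} {r : V → V → Prop} {s : W → W → Prop} {p : W → ℕ}
  {Y : IsoType}

theorem chainRel_not_symm {i j : Fin (n + 1)} (h : i ≠ j) :
    ¬(chainRel l n i j ↔ chainRel l n j i) := by
  rw [chainRel_of_ne h, chainRel_of_ne h.symm]
  omega

theorem chain_apply_ne_of_symm (f : chainRel l n ↪r r) {i : Fin (n + 1)} {z : V} (hz : f i ≠ z)
    (h : r (f i) z ↔ r z (f i)) (j : Fin (n + 1)) : f j ≠ z := by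
  rintro rfl
  rw [f.map_rel_iff, f.map_rel_iff] at h
  exact chainRel_not_symm (fun hij => hz (congrArg f hij)) h

theorem marked_symm (i : Fin (n + 1)) (x : W) :
    marked l n s p (.inr x) (.inl i) ↔ marked l n s p (.inl i) (.inr x) := Iff.rfl

theorem chain_marked_apply [Finite W] (hn : Nat.card W ≤ n) (k : chainRel l n ↪r marked l n s p)
    (i : Fin (n + 1)) : k i = .inl i := by
  refine apply_eq_of_same_range k (labelledChain l n s _) (fun i => ?_) i
  by_contra! hi
  obtain ⟨x, hx⟩ : ∃ x, k i = .inr x := by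
    rcases hki : k i with j | x
    · exact (hi j hki.symm).elim
    · exact ⟨x, rfl⟩
  have hall : ∀ j, ∃ x, k j = .inr x := fun j => by
    rcases hkj : k j with m | x'
    · refine (chain_apply_ne_of_symm k (i := i) (z := k j) ?_ ?_ j rfl).elim
      · rw [hx, hkj]
        exact Sum.inr_ne_inl
      · rw [hx, hkj]
        exact marked_symm m x
    · exact ⟨x', rfl⟩
  choose c hc using hall
  have hcard := Nat.card_le_card_of_injective c fun a b hab => k.injective (by rw [hc, hc, hab])
  rw [Nat.card_fin] at hcard
  omega

namespace Alike

variable [Finite W]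

theorem exists_marked_type (h : Alike (stage i) (mk (marked l n s p)) Y) (hi : 5 ≤ i)
    (hp : IsMarking n p) (l' : Prop) :
    Nonempty (marked l n (Subrel s fun x => s x x ↔ l') (fun x => p x) ↪r Y.E) := by
  refine h.embedding ?_ (labelledMap l n (Subrel.relEmbedding s _) fun _ => p)
  rcases iff_or_iff_not l' l with hl | hl
  · refine stage_mono hi (mk_mem_stage_of_loop_iff (l := l) ?_)
    rintro (j | x)
    · exact chainRel_self j
    · exact x.2.trans hl
  · exact stage_mono ((by omega : 4 ≤ 5).trans hi) (mk_marked_mem_stage_of_loop_iff_not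
      (fun x => x.2.trans hl) (hp.comp Subtype.val_injective))

theorem eq_chain (h : Alike (stage i) (mk (marked l n s p)) Y) (hi : 5 ≤ i) (hp : IsMarking n p)
    (hn : Nat.card W ≤ n) (f k : chainRel l n ↪r Y.E) (j : Fin (n + 1)) : k j = f j := by
  obtain ⟨g⟩ := h.exists_marked_type hi hp l
  have hsub : typeCount l (Subrel s fun x => s x x ↔ l) = typeCount l s :=
    typeCount_eq_card fun x => x.2
  have happly : ∀ e : chainRel l n ↪r Y.E, e j = g (.inl j) := fun e => by
    obtain ⟨e', he'⟩ := exists_factor g e fun a =>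
      exists_apply_eq_of_typeCount_le g
        (by rw [h.typeCount_eq, typeCount_labelled, typeCount_labelled, hsub])
        (loop_map e (chainRel_self a))
    rw [← he', chain_marked_apply ((Finite.card_subtype_le _).trans hn)]
  rw [happly, happly]

theorem exists_isSkeleton (h : Alike (stage i) (mk (marked l n s p)) Y) (hi : 5 ≤ i)
    (hp : IsMarking n p) (hn : Nat.card W ≤ n) :
    ∃ (f : chainRel l n ↪r Y.E) (y : W → Y.V), IsSkeleton f y p ∧
      ∀ x x', (s x x ↔ s x' x') → (Y.E (y x) (y x') ↔ s x x') := by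
  obtain ⟨f⟩ := h.exists_chain (labelledChain l n s _)
  have hf := h.eq_chain hi hp hn f
  obtain ⟨y, hy⟩ := hp.exists_isSkeleton hf (fun x => by
    obtain ⟨e⟩ := h.exists_marked_type hi hp (s x x)
    exact ⟨_, hasMark_of_eq_chain hf e ⟨x, Iff.rfl⟩⟩) h.card_eq.le
  refine ⟨f, y, hy, fun x x' hxx => ?_⟩
  obtain ⟨e⟩ := h.exists_marked_type hi hp (s x x)
  exact hy.rel_iff hp e ⟨x, Iff.rfl⟩ ⟨x', hxx.symm⟩

end Alike

namespace IsSkeleton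

variable {f : chainRel l n ↪r r} {y : Bool → V} {p : Bool → ℕ}

theorem eq_true_of_loop_iff (h : IsSkeleton f y p) (hy : r (y false) (y false) ↔ ¬l) {z : V}
    (hz : r z z ↔ l) (hfz : ∀ i, f i ≠ z) : z = y true := by
  obtain ⟨_ | _, rfl⟩ := (h.cover z).resolve_left fun ⟨i, hi⟩ => hfz i hi
  · exact (ne_of_loop hz hy rfl).elim
  · rfl

theorem chain_ne_of_symm_pair (h : IsSkeleton f y p) (hy : r (y false) (y false) ↔ ¬l)
    {z a b : V} (hab : a ≠ b) (ha : r a a ↔ l) (hb : r b b ↔ l) (hza : z ≠ a) (hzb : z ≠ b)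
    (hsa : r z a ↔ r a z) (hsb : r z b ↔ r b z) (i : Fin (n + 1)) : f i ≠ z := by
  rintro rfl
  exact hab ((h.eq_true_of_loop_iff hy ha (chain_apply_ne_of_symm f hza hsa)).trans
    (h.eq_true_of_loop_iff hy hb (chain_apply_ne_of_symm f hzb hsb)).symm)

end IsSkeleton

theorem mk_marked_bool_mem_stage_of_mixed {s : Bool → Bool → Prop} {p : Bool → ℕ}
    (hs₀ : s false false ↔ ¬l) (hs₁ : s true true ↔ l) (hp : IsMarking n p) (hn : 2 ≤ n) :
    mk (marked l n s p) ∈ stage 6 :=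
  mem_stage_succ.2 fun Y h => by
    obtain ⟨f, y, hY, hy⟩ := h.exists_isSkeleton le_rfl hp (by simpa using hn)
    have hy₀ := (hy false false Iff.rfl).trans hs₀
    have hy₁ := (hy true true Iff.rfl).trans hs₁
    obtain ⟨w, hw⟩ := h.exists_image
      ![.inr false, .inr true, .inl ⟨0, by omega⟩, .inl ⟨1, by omega⟩]
    have hw₀ : w 0 = y false := by
      obtain ⟨_ | _, hb⟩ := hY.exists_of_loop_iff_not ((hw 0 0).1.trans hs₀)
      · exact hb.symm
      · exact (ne_of_loop hy₁ (hb ▸ (hw 0 0).1.trans hs₀) rfl).elim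
    have hw₁ : w 1 = y true := hY.eq_true_of_loop_iff hy₀ ((hw 1 1).1.trans hs₁)
      (hY.chain_ne_of_symm_pair hy₀ (a := w 2) (b := w 3)
        (fun hab => by simpa using (hw 2 3).2.1 hab)
        ((hw 2 2).1.trans (chainRel_self _)) ((hw 3 3).1.trans (chainRel_self _))
        (fun ha => Sum.inr_ne_inl ((hw 1 2).2.1 ha)) (fun hb => Sum.inr_ne_inl ((hw 1 3).2.1 hb))
        ((hw 1 2).1.trans (hw 2 1).1.symm) ((hw 1 3).1.trans (hw 3 1).1.symm))
    refine h.eq_of_embedding (hY.embedding hp ?_)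
    rintro (_ | _) (_ | _)
    · exact hy _ _ Iff.rfl
    · rw [← hw₀, ← hw₁]
      exact (hw 0 1).1
    · rw [← hw₀, ← hw₁]
      exact (hw 1 0).1
    · exact hy _ _ Iff.rfl

theorem mk_marked_mem_stage [Finite W] (hp : IsMarking n p) (hW : Nat.card W ≤ n) (hn : 2 ≤ n) :
    mk (marked l n s p) ∈ stage 7 :=
  mem_stage_succ.2 fun Y h => by
    obtain ⟨f, y, hY, hy⟩ := h.exists_isSkeleton (by omega) hp hW
    have hmixed : ∀ x x', (s x x ↔ ¬l) → (s x' x' ↔ l) →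
        (Y.E (y x) (y x') ↔ s x x') ∧ (Y.E (y x') (y x) ↔ s x' x) := fun x x' hx hx' => by
      have hne : x ≠ x' := (ne_of_loop hx' hx).symm
      obtain ⟨e⟩ := h.embedding
        (mk_marked_bool_mem_stage_of_mixed (s := fun a b => s (pair hne a) (pair hne b)) hx hx'
          (hp.comp (pair hne).injective) hn)
        (labelledMap l n (.preimage (pair hne) s) fun _ => p)
      exact ⟨hY.rel_iff hp e false true, hY.rel_iff hp e true false⟩
    refine h.eq_of_embedding (hY.embedding hp fun x x' => ?_)
    rcases iff_or_iff_not (s x x) l with hx | hx <;>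
      rcases iff_or_iff_not (s x' x') l with hx' | hx'
    · exact hy x x' (hx.trans hx'.symm)
    · exact (hmixed x' x hx' hx).2
    · exact (hmixed x x' hx hx').1
    · exact hy x x' (hx.trans hx'.symm)

end

/-! ### Adding a vertex -/

/-- The digraph `r` with a new vertex that is not of type `l`. It has edges to all vertices of type
`l`, and, in both directions, to all other vertices if `t` holds and to none of them otherwise. -/
def addVertex (l t : Prop) {V : Type} (r : V → V → Prop) : Option V → Option V → Prop
  | none, none => ¬l
  | none, some x => (r x x ↔ l) ∨ t
  | some x, none => (r x x ↔ ¬l) ∧ t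
  | some x, some y => r x y

/-- The vertex `x` is joined in both directions to all other vertices that are not of type `l` if
`t` holds, and to none of them otherwise. The new vertex of `addVertex l t r` is like this. -/
def UniformlyJoined (l t : Prop) {V : Type} (r : V → V → Prop) (x : V) : Prop :=
  ∀ y, (r y y ↔ ¬l) → y ≠ x → (r x y ↔ t) ∧ (r y x ↔ t)

section

variable {l t : Prop} {n : ℕ} {V W : Type} {r : V → V → Prop} {q : W → W → Prop} {Y : IsoType}

/-- The inclusion of `r` into `addVertex l t r`. -/
def addVertexEmbedding (l t : Prop) (r : V → V → Prop) : r ↪r addVertex l t r :=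
  ⟨⟨some, Option.some_injective V⟩, Iff.rfl⟩

theorem addVertex_none_some {x : V} (hx : r x x ↔ l) : addVertex l t r none (some x) := .inl hx

namespace UniformlyJoined

theorem of_embedding (e : r ↪r q) {x : V} (h : UniformlyJoined l t q (e x)) :
    UniformlyJoined l t r x := fun y hy hyx => by
  rw [← e.map_rel_iff, ← e.map_rel_iff (a := y)]
  exact h (e y) (loop_map e hy) (e.injective.ne hyx)

theorem map (e : r ↪r q) (hcover : ∀ z, (q z z ↔ ¬l) → ∃ y, e y = z) {x : V}
    (h : UniformlyJoined l t r x) : UniformlyJoined l t q (e x) := fun z hz hzx => by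
  obtain ⟨y, rfl⟩ := hcover z hz
  rw [e.map_rel_iff, e.map_rel_iff]
  exact h y (e.map_rel_iff.symm.trans hz) fun hyx => hzx (congrArg e hyx)

end UniformlyJoined

theorem uniformlyJoined_none : UniformlyJoined l t (addVertex l t r) none := by
  rintro (_ | x) hx hne
  · exact (hne rfl).elim
  · change r x x ↔ ¬l at hx
    simp only [addVertex]
    tauto

theorem exists_not_uniformlyJoined [Finite V] (hr : 2 ≤ typeCount (¬l) r) :
    ∃ t, ∀ x, (r x x ↔ ¬l) → ¬UniformlyJoined l t r x := by
  by_contra! h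
  obtain ⟨x, hx, hjoined⟩ := h True
  obtain ⟨y, hy, hapart⟩ := h False
  by_cases hxy : y = x
  · subst hxy
    have : Nontrivial {z // r z z ↔ ¬l} := Finite.one_lt_card_iff_nontrivial.1 hr
    obtain ⟨⟨z, hz⟩, hne⟩ := exists_ne (⟨y, hy⟩ : {z // r z z ↔ ¬l})
    have hzy : z ≠ y := fun hzy => hne (Subtype.ext hzy)
    exact (hapart z hz hzy).1.1 ((hjoined z hz hzy).1.2 trivial)
  · exact (hapart x hx (Ne.symm hxy)).1.1 ((hjoined y hy hxy).2.2 trivial)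

theorem uniformlyJoined_inr_none (p : Option V → ℕ) :
    UniformlyJoined l t (marked l n (addVertex l t r) p) (.inr none) :=
  uniformlyJoined_none.map (labelledVertices l n _ _) fun _ hz =>
    (exists_eq_inr_of_loop hz).imp fun _ => Eq.symm

theorem eq_inr_none_of_uniformlyJoined {p : Option V → ℕ}
    (hr : ∀ x, (r x x ↔ ¬l) → ¬UniformlyJoined l t r x) {z : Fin (n + 1) ⊕ Option V}
    (hz : marked l n (addVertex l t r) p z z ↔ ¬l)
    (h : UniformlyJoined l t (marked l n (addVertex l t r) p) z) : z = .inr none := by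
  obtain ⟨_ | x, rfl⟩ := exists_eq_inr_of_loop hz
  · rfl
  · exact (hr x hz (h.of_embedding
      ((addVertexEmbedding l t r).trans (labelledVertices l n _ fun _ => p)))).elim

theorem adj_of_apply_eq_inr_none {p : V → ℕ}
    (e : q ↪r marked l n (addVertex l t r) fun x => x.elim (n + 1) p) {b y : W}
    (hb : e b = .inr none) (hy : q y y ↔ l) : q b y := by
  have hy' := loop_map e hy
  rw [← e.map_rel_iff, hb]
  rcases hey : e y with j | _ | x <;> rw [hey] at hy'
  · exact j.2
  · exact (iff_not_self hy'.symm).elim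
  · exact addVertex_none_some hy'

theorem mk_addVertex_mem_stage [Finite V] (hr : ∀ x, (r x x ↔ ¬l) → ¬UniformlyJoined l t r x) :
    mk (addVertex l t r) ∈ stage 8 :=
  mem_stage_succ.2 fun Y h => by
    obtain ⟨p, hp, hpV⟩ := exists_pos_marking V
    let n := Nat.card V + 2
    have hp' : IsMarking n p := ⟨hp, fun x => by have := (hpV x).2; omega⟩
    have hmem : ∀ c ≤ n + 1, (∀ x, p x ≠ c) →
        mk (marked l n (addVertex l t r) fun x => x.elim c p) ∈ stage 7 := fun c hcn hc =>
      mk_marked_mem_stage (hp'.option hcn hc) (by rw [Finite.card_option]; omega) (by omega)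
    obtain ⟨e⟩ := h.embedding_into
      (hmem 0 (Nat.zero_le _) fun x => (hpV x).1.ne') (labelledVertices l n _ _)
    obtain ⟨e'⟩ := h.embedding_into
      (hmem (n + 1) le_rfl fun x => by have := (hpV x).2; omega) (labelledVertices l n _ _)
    have hcount : ∀ q, typeCount (¬l) (marked l n (addVertex l t r) q) ≤ typeCount (¬l) Y.E :=
      fun q => by rw [typeCount_labelled, typeCount_not_chainRel, zero_add, h.typeCount_eq]
    obtain ⟨b, hb'⟩ := exists_apply_eq_of_typeCount_le e' (hcount _) (y := .inr none) Iff.rfl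
    have hloop : Y.E b b ↔ ¬l := by
      rw [← e'.map_rel_iff, hb']
      exact Iff.rfl
    have hjoined : UniformlyJoined l t Y.E b :=
      .of_embedding e' (hb' ▸ uniformlyJoined_inr_none _)
    have hb : e b = .inr none := eq_inr_none_of_uniformlyJoined hr (loop_map e hloop)
      (hjoined.map e fun _ => exists_apply_eq_of_typeCount_le e (hcount _))
    refine h.eq_of_factor (labelledVertices l n _ _) e fun y => ?_
    rcases hy : e y with i | x
    · have hyl : Y.E y y ↔ l := by
        rw [← e.map_rel_iff, hy]
        exact chainRel_self i
      have hadj := e.map_rel_iff.2 (adj_of_apply_eq_inr_none e' hb' hyl)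
      rw [hb, hy] at hadj
      exact (Nat.not_lt_zero _ hadj).elim
    · exact ⟨x, rfl⟩

end

/-! ### All digraphs -/

section

variable {l : Prop} {V : Type} [Finite V] [Nonempty V] {r : V → V → Prop}

theorem mk_mem_stage_of_two_le (hr : 2 ≤ typeCount (¬l) r) : mk r ∈ stage 9 :=
  mem_stage_succ.2 fun Y h => by
    obtain ⟨t, ht⟩ := exists_not_uniformlyJoined hr
    obtain ⟨e⟩ := h.embedding_into (mk_addVertex_mem_stage ht) (addVertexEmbedding l t r)
    refine h.eq_of_factor (addVertexEmbedding l t r) e fun a => ?_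
    rcases ha : e a with _ | x
    · have hloop : Y.E a a ↔ ¬l := by
        rw [← e.map_rel_iff, ha]
        exact Iff.rfl
      have hjoined : UniformlyJoined l t Y.E a := .of_embedding e (ha ▸ uniformlyJoined_none)
      have : Nonempty {x // r x x ↔ ¬l} := (Nat.card_pos_iff.1 (two_pos.trans_le hr)).1
      have hsub : ∀ x, Subrel r (fun x => r x x ↔ ¬l) x x ↔ ¬l := fun x => x.2
      obtain ⟨k⟩ := h.embedding (stage_mono (by omega) (mk_mem_stage_of_loop_iff hsub))
        (Subrel.relEmbedding r _)
      obtain ⟨x, hx⟩ := exists_apply_eq_of_typeCount_le k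
        (by rw [h.typeCount_eq, typeCount_eq_card hsub]; exact le_rfl) hloop
      have hjoined' := (hx ▸ hjoined).of_embedding k
      exact (ht x x.2 (hjoined'.map (Subrel.relEmbedding r _) fun z hz => ⟨⟨z, hz⟩, rfl⟩)).elim
    · exact ⟨x, rfl⟩

theorem mk_mem_stage_of_card_le_four (hr : Nat.card V ≤ 4) (i : ℕ) : mk r ∈ stage (i + 1) :=
  mem_stage_succ.2 fun Y h => by
    have : Fintype V := Fintype.ofFinite V
    obtain ⟨g⟩ : Nonempty (V ↪ Fin 4) := Function.Embedding.nonempty_of_card_le (by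
      rwa [Fintype.card_fin, ← Nat.card_eq_fintype_card])
    obtain ⟨w, hw⟩ := h.exists_image (Function.invFun g)
    have hinv : ∀ x, Function.invFun g (g x) = x := Function.leftInverse_invFun g.injective
    refine h.eq_of_embedding ⟨⟨fun x => w (g x), fun x y hxy => ?_⟩, fun {x y} => ?_⟩
    · rw [← hinv x, ← hinv y, (hw _ _).2.1 hxy]
    · have hiff := (hw (g x) (g y)).1
      rwa [hinv, hinv] at hiff

end

theorem stage_nine : stage 9 = Set.univ := by
  refine Set.eq_univ_of_forall fun X => ?_
  rw [← mk_E X]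
  by_cases hX : ∃ l, 2 ≤ typeCount (¬l) X.E
  · obtain ⟨l, hl⟩ := hX
    exact mk_mem_stage_of_two_le hl
  · push Not at hX
    have hfalse := hX False
    rw [not_false_eq_true] at hfalse
    have htrue := hX True
    have hadd := card_eq_typeCount_add X.E True
    exact mk_mem_stage_of_card_le_four (by omega) 8

theorem hasDefinableCodes_stage (i : ℕ) : HasDefinableCodes (stage i) := by
  induction i with
  | zero => exact hasDefinableCodes_chains
  | succ i ih => exact ih.determined

theorem OrderDefinable.isCodeOf {α : Type} (i j k : α) :
    OrderDefinable fun v => IsCodeOf (v i) (v j) (v k) :=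
  (hasDefinableCodes_stage 9 i j k).congr fun v => by simp [stage_nine]

/-! ### Translation of second-order formulas -/

section Translation

open SOContext DefinablePred

/-- The first-order variables into which the variables of a context are translated. A digraph is
represented by a code, which consists of two digraphs, a vertex by its number, and a relation of
arity `k` by an index set and `k` binary relations between indices and vertices. -/
inductive CodeVar (c : SOContext) : Type
  | size (i : c.Dig)
  | code (i : c.Dig)
  | vtx {i : c.Dig} (x : c.Vtx i)
  | rel {k : ℕ} {s : Fin k → c.Dig} (R : c.Rel s) (j : Fin (k + 1))

/-- The tuple `y` belongs to the relation represented by `x`: for some index `T`, the entry `y j`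
is the number to which the binary relation coded by `x j.succ` takes `T`. -/
def TupleCodes {k : ℕ} (x : Fin (k + 1) → IsoType) (y : Fin k → IsoType) : Prop :=
  ∃ T, (∃ n, T = numeral n) ∧ Codes (x 0) T T ∧ ∀ j, Codes (x j.succ) T (y j)

/-- The valuation `v` represents the assignment `a`. -/
structure Represents {c : SOContext} (v : CodeVar c → IsoType) (a : c.Assignment) : Prop where
  size : ∀ i, v (.size i) = numeral (a.dig i).n
  code : ∀ i (x y : (a.dig i).V),
    Codes (v (.code i)) (numeral x) (numeral y) ↔ (a.dig i).E x y
  vtx : ∀ i (x : c.Vtx i), v (.vtx x) = numeral (a.vtx i x)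
  rel : ∀ k (s : Fin k → c.Dig) (R : c.Rel s) (x : ∀ j, (a.dig (s j)).V),
    x ∈ a.rel k s R ↔ TupleCodes (fun j => v (.rel R j)) fun j => numeral (x j)

theorem OrderDefinable.tupleCodes {α : Type} {k : ℕ} (x : Fin (k + 1) → α) (y : Fin k → α) :
    OrderDefinable fun v => TupleCodes (fun j => v (x j)) fun j => v (y j) :=
  exists_elem (.and (isChain True _) (.and (codes _ _ _) (forall_index fun _ => codes _ _ _)))

theorem exists_tupleCodes {k : ℕ} {n : Fin k → ℕ} (S : Set (∀ j, Fin (n j + 1))) :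
    ∃ x : Fin (k + 1) → IsoType, ∀ y : ∀ j, Fin (n j + 1),
      y ∈ S ↔ TupleCodes x fun j => numeral (y j) := by
  let e := Finite.equivFin S
  obtain ⟨T, hT⟩ := exists_codes (fun i j => i = j ∧ i < Nat.card S) (Nat.card S)
    fun i j h => by omega
  have hentry : ∀ j, ∃ U, ∀ i b, Codes U (numeral i) (numeral b) ↔
      ∃ h : i < Nat.card S, ((e.symm ⟨i, h⟩).1 j : ℕ) = b := fun j =>
    exists_codes _ (Nat.card S + n j) (by
      rintro i b ⟨h, rfl⟩
      have := ((e.symm ⟨i, h⟩).1 j).2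
      omega)
  choose U hU using hentry
  refine ⟨Fin.cons T U, fun y => ⟨fun hy => ⟨numeral (e ⟨y, hy⟩), ⟨_, rfl⟩, ?_, fun j => ?_⟩, ?_⟩⟩
  · exact (hT _ _).2 ⟨rfl, (e ⟨y, hy⟩).2⟩
  · rw [Fin.cons_succ, hU]
    exact ⟨(e ⟨y, hy⟩).2, by rw [Fin.eta, e.symm_apply_apply]⟩
  · rintro ⟨-, ⟨i, rfl⟩, h₀, h⟩
    have hi := ((hT _ _).1 h₀).2
    have hy : y = (e.symm ⟨i, hi⟩).1 := funext fun j => by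
      have := h j
      rw [Fin.cons_succ, hU] at this
      exact Fin.ext this.2.symm
    rw [hy]
    exact (e.symm ⟨i, hi⟩).2

namespace CodeVar

variable {c : SOContext}

/-- The variables after adding a digraph variable: the old ones, and the size and the code of the
new digraph. -/
def addDig : CodeVar c.addDig → CodeVar c ⊕ Bool
  | size none => .inr false
  | size (some i) => .inl (size i)
  | code none => .inr true
  | code (some i) => .inl (code i)
  | vtx (VtxLift.old x) => .inl (vtx x)
  | rel (RelLift.old R) j => .inl (rel R j)

/-- The variables after adding a vertex variable: the old ones, and the new vertex. -/
def addVtx {i : c.Dig} : CodeVar (c.addVtx i) → CodeVar c ⊕ Unit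
  | size i => .inl (size i)
  | code i => .inl (code i)
  | vtx (VtxExt.old x) => .inl (vtx x)
  | vtx VtxExt.new => .inr ()
  | rel R j => .inl (rel (c := c) R j)

/-- The variables after adding a relation variable: the old ones, and the index set and the binary
relations of the new relation. -/
def addRel {m : ℕ} {t : Fin m → c.Dig} : CodeVar (c.addRel t) → CodeVar c ⊕ Fin (m + 1)
  | size i => .inl (size i)
  | code i => .inl (code i)
  | vtx x => .inl (vtx (c := c) x)
  | rel (RelExt.old R) j => .inl (rel R j)
  | rel RelExt.new j => .inr j

/-- The variables of a context with digraph variables only: the size and the code of each of these.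
The values of the digraph variables themselves are kept as the left summand. -/
def digraphs {n : ℕ} : CodeVar (SOContext.digraphs n) → Fin n ⊕ Fin n × Bool
  | size i => .inr (i, false)
  | code i => .inr (i, true)
  | vtx x => nomatch x
  | rel R _ => nomatch R

end CodeVar

namespace Represents

variable {c : SOContext} {v : CodeVar c → IsoType} {a : c.Assignment}

theorem addDig (h : Represents v a) {x : Bool → IsoType} {G : FinDigraph}
    (hsize : x false = numeral G.n)
    (hcode : ∀ y z : G.V, Codes (x true) (numeral y) (numeral z) ↔ G.E y z) :
    Represents (fun u => Sum.elim v x u.addDig) (a.addDig G) where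
  size
    | none => hsize
    | some i => h.size i
  code
    | none => hcode
    | some i => h.code i
  vtx
    | _, VtxLift.old x => h.vtx _ x
  rel
    | _, _, RelLift.old R => h.rel _ _ R

theorem addVtx (h : Represents v a) {i : c.Dig} {x : Unit → IsoType} {y : (a.dig i).V}
    (hx : x () = numeral y) :
    Represents (fun u => Sum.elim v x (CodeVar.addVtx (i := i) u)) (a.addVtx i y) where
  size := h.size
  code := h.code
  vtx
    | _, VtxExt.old x => h.vtx _ x
    | _, VtxExt.new => hx
  rel := h.rel

theorem addRel (h : Represents v a) {m : ℕ} {t : Fin m → c.Dig} {x : Fin (m + 1) → IsoType}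
    {S : Set (∀ j, (a.dig (t j)).V)} (hx : ∀ y, y ∈ S ↔ TupleCodes x fun j => numeral (y j)) :
    Represents (fun u => Sum.elim v x (CodeVar.addRel (t := t) u)) (a.addRel t S) where
  size := h.size
  code := h.code
  vtx := h.vtx
  rel
    | _, _, RelExt.old R => h.rel _ _ R
    | _, _, RelExt.new => hx

end Represents

/-- The translation of a second-order formula into the language of the poset, as a predicate on
valuations of the variables that represent those of its context. -/
def Translation : {c : SOContext} → SOFormula c → (CodeVar c → IsoType) → Prop
  | _, .falsum, _ => False
  | _, .eq x y, v => v (.vtx x) = v (.vtx y)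
  | _, @SOFormula.edge _ i x y, v => Codes (v (.code i)) (v (.vtx x)) (v (.vtx y))
  | _, .mem R x, v => TupleCodes (fun j => v (.rel R j)) fun j => v (.vtx (x j))
  | _, .imp φ ψ, v => Translation φ v → Translation ψ v
  | _, .allDig φ, v => ∀ x : Bool → IsoType, (∃ n, x false = numeral n) →
      Translation φ fun u => Sum.elim v x u.addDig
  | _, .allVtx i φ, v => ∀ x : Unit → IsoType, x () ≤ v (.size i) →
      Translation φ fun u => Sum.elim v x u.addVtx
  | _, .allRel _ φ, v => ∀ x, Translation φ fun u => Sum.elim v x u.addRel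

theorem orderDefinable_translation {c : SOContext} (φ : SOFormula c) :
    OrderDefinable (Translation φ) := by
  induction φ with
  | falsum => exact const False
  | eq x y => exact .eq _ _
  | edge x y => exact .codes _ _ _
  | mem R x => exact .tupleCodes _ _
  | imp φ ψ hφ hψ => exact hφ.imp hψ
  | allDig φ hφ => exact forall_tuple ((OrderDefinable.isChain True _).imp (hφ.comp_sumElim _))
  | allVtx i φ hφ => exact forall_tuple ((OrderDefinable.le _ _).imp (hφ.comp_sumElim _))
  | allRel t φ hφ => exact forall_tuple (hφ.comp_sumElim _)

theorem translation_iff_realize {c : SOContext} (φ : SOFormula c) {v : CodeVar c → IsoType}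
    {a : c.Assignment} (h : Represents v a) : Translation φ v ↔ φ.Realize a := by
  induction φ with
  | falsum => rfl
  | eq x y => simp only [Translation, SOFormula.Realize, h.vtx, numeral_inj]
  | edge x y => simp only [Translation, SOFormula.Realize, h.vtx, h.code]
  | mem R x => simp only [Translation, SOFormula.Realize, h.vtx, h.rel]
  | imp φ ψ hφ hψ => exact imp_congr (hφ h) (hψ h)
  | allDig φ hφ =>
    refine ⟨fun hall G => ?_, fun hall x ⟨n, hn⟩ => ?_⟩
    · obtain ⟨S, hS⟩ := exists_codes_fin G.E
      exact (hφ (h.addDig (x := fun b => if b then S else numeral G.n) rfl hS)).1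
        (hall _ ⟨_, rfl⟩)
    · exact (hφ (h.addDig (G := decode n (x true)) hn fun _ _ => Iff.rfl)).2 (hall _)
  | allVtx i φ hφ =>
    refine ⟨fun hall y => ?_, fun hall x hx => ?_⟩
    · exact (hφ (h.addVtx (x := fun _ => numeral y) rfl)).1
        (hall _ (by rw [h.size]; exact le_numeral_iff.2 ⟨y, rfl⟩))
    · rw [h.size, le_numeral_iff] at hx
      obtain ⟨y, hy⟩ := hx
      exact (hφ (h.addVtx hy)).2 (hall y)
  | allRel t φ hφ =>
    refine ⟨fun hall S => ?_, fun hall x => ?_⟩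
    · obtain ⟨x, hx⟩ := exists_tupleCodes S
      exact (hφ (h.addRel hx)).1 (hall x)
    · exact (hφ (h.addRel (S := {y | TupleCodes x fun j => numeral (y j)}) fun _ => Iff.rfl)).2
        (hall _)

theorem represents_digraphs {n : ℕ} (v : Fin n → IsoType) {x : Fin n × Bool → IsoType}
    {G : Fin n → FinDigraph} (hsize : ∀ i, x (i, false) = numeral (G i).n)
    (hcode : ∀ i, decode (G i).n (x (i, true)) = G i) :
    Represents (fun u => Sum.elim v x u.digraphs) (Assignment.ofDigraphs G) where
  size := hsize
  code i := decode_eq_iff.1 (hcode i)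
  vtx _ x := nomatch x
  rel _ _ R := nomatch R

theorem orderDefinable_relation {n : ℕ} (φ : SOFormula (SOContext.digraphs n)) :
    OrderDefinable fun v => v ∈ φ.relation := by
  have hdef : OrderDefinable fun v : Fin n → IsoType => ∃ x : Fin n × Bool → IsoType,
      (∀ i, IsCodeOf (v i) (x (i, false)) (x (i, true))) ∧
        Translation φ fun u => Sum.elim v x u.digraphs :=
    exists_tuple (.and (forall_index fun _ => OrderDefinable.isCodeOf _ _ _)
      ((orderDefinable_translation φ).comp_sumElim _))
  refine hdef.congr fun v => ⟨?_, ?_⟩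
  · rintro ⟨x, hx, hφ⟩
    choose m hm hv using hx
    exact ⟨fun i => decode (m i) (x (i, true)), fun i => (hv i).symm,
      (translation_iff_realize φ (represents_digraphs v hm fun _ => rfl)).1 hφ⟩
  · rintro ⟨G, hG, hφ⟩
    choose S hS using fun i => exists_decode_eq (G i)
    refine ⟨fun p => if p.2 then S p.1 else numeral (G p.1).n, fun i => ⟨(G i).n, rfl, ?_⟩,
      (translation_iff_realize φ (represents_digraphs v (fun _ => rfl) hS)).2 hφ⟩
    simp [hS, hG]

end Translation

/-! ### Weakly connected digraphs and single digraphs -/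

theorem weaklyConnected_iff {G : FinDigraph} : G.WeaklyConnected ↔
    ∀ i, ∀ A : Set G.V, i ∈ A → (∀ j k, j ∈ A → G.E j k → k ∈ A) →
      (∀ j k, j ∈ A → G.E k j → k ∈ A) → ∀ j, j ∈ A := by
  constructor
  · intro h i A hi hout hin j
    obtain ⟨w⟩ := h.preconnected i j
    induction w with
    | nil => exact hi
    | cons hadj _ ih =>
      exact ih (((SimpleGraph.fromRel_adj _ _ _).1 hadj).2.elim (hout _ _ hi) (hin _ _ hi))
  · intro h
    let H := G.graph.toSimpleGraphInclusive
    have hstep : ∀ i j k, H.Reachable i j → (G.E j k ∨ G.E k j) → H.Reachable i k := by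
      intro i j k hij hjk
      by_cases hne : j = k
      · exact hne ▸ hij
      · exact hij.trans (SimpleGraph.Adj.reachable ((SimpleGraph.fromRel_adj _ _ _).2 ⟨hne, hjk⟩))
    exact ⟨fun i => h i {j | H.Reachable i j} (.refl i)
      (fun j k hj hjk => hstep i j k hj (.inl hjk)) fun j k hj hkj => hstep i j k hj (.inr hkj)⟩

/-- The second-order formula which says that a set of vertices contains every vertex as soon as
it contains one and is closed under successors and predecessors. -/
def weaklyConnectedFormula : SOFormula (SOContext.digraphs 1) :=
  .allVtx (0 : Fin 1) (.allRel (fun _ : Fin 1 => (0 : Fin 1)) (.imp (.mem .new fun _ => .new)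
    (.imp (.allVtx (0 : Fin 1) (.allVtx (0 : Fin 1) (.imp (.mem .new fun _ => .old .new)
        (.imp (.edge (.old .new) .new) (.mem .new fun _ => .new)))))
      (.imp (.allVtx (0 : Fin 1) (.allVtx (0 : Fin 1) (.imp (.mem .new fun _ => .old .new)
          (.imp (.edge .new (.old .new)) (.mem .new fun _ => .new)))))
        (.allVtx (0 : Fin 1) (.mem .new fun _ => .new))))))

theorem realize_weaklyConnectedFormula (G : Fin 1 → FinDigraph) :
    weaklyConnectedFormula.Realize (SOContext.Assignment.ofDigraphs G) ↔
      (G 0).WeaklyConnected := by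
  rw [weaklyConnected_iff]
  exact ⟨fun h i A => h i {f : Fin 1 → (G 0).V | f 0 ∈ A},
    fun h i (S : Set (Fin 1 → (G 0).V)) => h i {j | (fun _ => j) ∈ S}⟩

theorem eq_succ_iff_numeral {k n : ℕ} :
    n = k + 1 ↔ ∀ Y, Y ≤ numeral k ↔ Y ≤ numeral n ∧ Y ≠ numeral n := by
  constructor
  · rintro rfl Y
    refine ⟨fun h => ⟨h.trans (chain_le_chain.2 k.le_succ), ?_⟩, fun ⟨h, hne⟩ => ?_⟩
    · rintro rfl
      exact k.not_succ_le_self (chain_le_chain.1 h)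
    · obtain ⟨m, hm, rfl⟩ := le_chain_iff.1 h
      rw [ne_eq, chain_inj] at hne
      exact chain_le_chain.2 (by omega)
  · intro h
    have hk := h (numeral k)
    have hsucc := h (numeral (k + 1))
    simp only [chain_le_chain, ne_eq, chain_inj] at hk hsucc
    omega

theorem numeral_zero_mem_smallDigraphs : numeral 0 ∈ smallDigraphs :=
  mk_mem_smallDigraphs _ (by simp)

namespace OrderDefinable

open DefinablePred

variable {α : Type}

theorem weaklyConnected (i : α) : OrderDefinable fun v => v i ∈ IsoType.weaklyConnected :=
  ((orderDefinable_relation weaklyConnectedFormula).comp fun _ => i).congr fun v => by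
    constructor
    · rintro ⟨G, hG, h⟩
      exact ⟨G 0, hG 0, (realize_weaklyConnectedFormula G).1 h⟩
    · rintro ⟨G, hG, h⟩
      exact ⟨fun _ => G, fun _ => hG, (realize_weaklyConnectedFormula _).2 h⟩

theorem eq_numeral (k : ℕ) (i : α) : OrderDefinable fun v => v i = numeral k := by
  induction k generalizing α with
  | zero => exact eq_of_mem numeral_zero_mem_smallDigraphs i
  | succ k ih =>
    have hdef : OrderDefinable fun v : α → IsoType => (∃ n, v i = numeral n) ∧
        ∀ Y, Y ≤ numeral k ↔ Y ≤ v i ∧ Y ≠ v i :=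
      (isChain True i).and (subst (p := fun v K => ∀ Y, Y ≤ K ↔ Y ≤ v i ∧ Y ≠ v i) (ih ())
        (forall_elem ((le _ _).iff ((le _ _).and (eq _ _).not))))
    refine hdef.congr fun v => ⟨?_, fun h => ⟨⟨_, h⟩, h ▸ eq_succ_iff_numeral.1 rfl⟩⟩
    rintro ⟨⟨n, hn⟩, h⟩
    rw [hn] at h ⊢
    rw [eq_succ_iff_numeral.2 h]

theorem codes_numeral (m n : ℕ) (i : α) :
    OrderDefinable fun v => Codes (v i) (numeral m) (numeral n) := by
  have hright : ∀ {β : Type} (i j : β), OrderDefinable fun v => Codes (v i) (v j) (numeral n) :=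
    fun i j => subst (p := fun v N => Codes (v i) (v j) N) (eq_numeral n ()) (codes _ _ _)
  exact subst (p := fun v M => Codes (v i) M (numeral n)) (eq_numeral m ()) (hright _ _)

theorem isCodeOf_numeral (n : ℕ) (i j : α) :
    OrderDefinable fun v => IsCodeOf (v i) (numeral n) (v j) :=
  subst (p := fun v K => IsCodeOf (v i) K (v j)) (eq_numeral n ()) (isCodeOf _ _ _)

theorem eq_const (X : IsoType) (i : α) : OrderDefinable fun v => v i = X := by
  obtain ⟨G, rfl⟩ : ∃ G, X = of G := ⟨_, (of_out X).symm⟩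
  have hdef : OrderDefinable fun v : α → IsoType => ∃ S, IsCodeOf (v i) (numeral G.n) S ∧
      ∀ j k : G.V, Codes S (numeral j) (numeral k) ↔ G.E j k :=
    exists_elem (.and (isCodeOf_numeral G.n _ _)
      (forall_index fun j => forall_index fun k => (codes_numeral j k _).iff (const _)))
  refine hdef.congr fun v => ⟨?_, fun h => ?_⟩
  · rintro ⟨S, ⟨n, hn, hX⟩, hS⟩
    obtain rfl := chain_inj.1 hn
    rw [hX, decode_eq_iff.2 hS]
  · obtain ⟨S, hS⟩ := exists_decode_eq G
    exact ⟨S, ⟨G.n, rfl, by rw [h, hS]⟩, decode_eq_iff.1 hS⟩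

end OrderDefinable

end DigraphOrder

open DigraphOrder FirstOrder in
theorem corollary2 :
    ∃ C : Finset IsoType,
      (∀ G : IsoType, (C : Set IsoType).Definable₁ Language.order {G}) ∧
      (C : Set IsoType).Definable₁ Language.order IsoType.weaklyConnected ∧
      ∀ (n : ℕ) (φ : SOFormula (SOContext.digraphs n)),
        (C : Set IsoType).Definable Language.order φ.relation :=
  ⟨smallDigraphs, fun G => OrderDefinable.eq_const G 0, OrderDefinable.weaklyConnected 0,
    fun _ φ => orderDefinable_relation φ⟩
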